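/- Let $BV(\mathbb{R})$ be the space of functions $f:\mathbb{R}\to\mathbb{R}$ of bounded (pointwise) total variation $\mathrm{Var}(f)$ over $\mathbb{R}$, with the norm $\|f\|_{BV}=|f(-\infty)|+\mathrm{Var}(f)$, where $f(-\infty)=\lim_{x\to-\infty}f(x)$. For $f\in BV(\mathbb{R})$ let $$\widetilde{M}f(x)=\sup_{a<x<b}\frac{1}{b-a}\int_a^b|f(t)|\,dt\qquad(x\in\mathbb{R})$$ be the uncentered Hardy–Littlewood maximal function. Theorem. The operator $\widetilde{M}$ maps $BV(\mathbb{R})$ into itself, and $\widetilde{M}:BV(\mathbb{R})\to BV(\mathbb{R})$ is continuous. Equivalently: for every $f\in BV(\mathbb{R})$ the function $\widetilde{M}f$ is of bounded variation and is absolutely continuous on every compact interval, its almost everywhere defined derivative $(\widetilde{M}f)'$ belongs to $L^1(\mathbb{R})$, and whenever $f_j,f\in BV(\mathbb{R})$ satisfy $\|f_j-f\|_{BV}\to0$, one has $\widetilde{M}f_j(-\infty)\to\widetilde{M}f(-\infty)$ and $(\widetilde{M}f_j)'\to(\widetilde{M}f)'$ in $L^1(\mathbb{R})$. -/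

import Mathlib

open Filter Topology MeasureTheory

namespace BVMax

/-- The limit `f(-∞)` of a function on the real line at `-∞`. -/
noncomputable def limAtBot (f : ℝ → ℝ) : ℝ := limUnder atBot f

/-- The total variation `Var(f)` of a real function over the whole line. -/
noncomputable def totalVar (f : ℝ → ℝ) : ℝ := (eVariationOn f Set.univ).toReal

/-- The uncentered Hardy-Littlewood maximal function: the supremum of the averages of `|f|` over
all bounded open intervals (the balls of the real line) that contain `x`. -/
noncomputable def uncenteredMaximal (f : ℝ → ℝ) (x : ℝ) : ℝ :=
  ⨆ I : {I : ℝ × ℝ // x ∈ Set.Ioo I.1 I.2}, ⨍ t in Set.Ioo I.1.1 I.1.2, |f t|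

theorem eVariationOn_add_le (f g : ℝ → ℝ) (s : Set ℝ) :
    eVariationOn (f + g) s ≤ eVariationOn f s + eVariationOn g s := by
  refine iSup_le fun p => ?_
  calc ∑ i ∈ Finset.range p.1, edist ((f + g) (p.2.1 (i + 1))) ((f + g) (p.2.1 i))
      ≤ ∑ i ∈ Finset.range p.1, (edist (f (p.2.1 (i + 1))) (f (p.2.1 i))
          + edist (g (p.2.1 (i + 1))) (g (p.2.1 i))) :=
        Finset.sum_le_sum fun i _ => edist_add_add_le _ _ _ _
    _ = ∑ i ∈ Finset.range p.1, edist (f (p.2.1 (i + 1))) (f (p.2.1 i))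
          + ∑ i ∈ Finset.range p.1, edist (g (p.2.1 (i + 1))) (g (p.2.1 i)) :=
        Finset.sum_add_distrib
    _ ≤ _ := add_le_add (eVariationOn.sum_le p.2.2.1 p.2.2.2)
        (eVariationOn.sum_le p.2.2.1 p.2.2.2)

theorem eVariationOn_neg (f : ℝ → ℝ) (s : Set ℝ) :
    eVariationOn (-f) s = eVariationOn f s := by
  simp only [eVariationOn, Pi.neg_apply, edist_neg_neg]

theorem eVariationOn_zero (s : Set ℝ) : eVariationOn (0 : ℝ → ℝ) s = 0 := by
  simp [eVariationOn]

/-- The additive group of real functions of bounded variation on the line. -/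
def bvSubgroup : AddSubgroup (ℝ → ℝ) where
  carrier := {f | BoundedVariationOn f Set.univ}
  zero_mem' := by simp [BoundedVariationOn, eVariationOn_zero]
  add_mem' := fun {f g} hf hg =>
    ne_top_of_le_ne_top (ENNReal.add_ne_top.2 ⟨hf, hg⟩) (eVariationOn_add_le f g _)
  neg_mem' := fun {f} hf => by
    simpa only [Set.mem_ofPred_eq, BoundedVariationOn, eVariationOn_neg] using hf

/-- The space `BV(ℝ)` of functions `f : ℝ → ℝ` of bounded variation. It is a type of its own, so
that it carries the topology of the norm below and not the one of pointwise convergence. -/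
def BV : Type := bvSubgroup

namespace BV

/-- The function underlying an element of `BV(ℝ)`. -/
def toFun (f : BV) : ℝ → ℝ := f.1

instance : CoeFun BV (fun _ => ℝ → ℝ) := ⟨toFun⟩

/-- A function of bounded variation, as an element of `BV(ℝ)`. -/
def mk (f : ℝ → ℝ) (hf : BoundedVariationOn f Set.univ) : BV := ⟨f, hf⟩

theorem toFun_mk (f : ℝ → ℝ) (hf : BoundedVariationOn f Set.univ) : (mk f hf).toFun = f := rfl

theorem boundedVariationOn (f : BV) : BoundedVariationOn f Set.univ := f.2

theorem ext {f g : BV} (h : f.toFun = g.toFun) : f = g := Subtype.ext h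

instance : AddCommGroup BV := inferInstanceAs (AddCommGroup bvSubgroup)

theorem toFun_zero : (0 : BV).toFun = 0 := rfl

theorem toFun_add (f g : BV) : (f + g).toFun = f.toFun + g.toFun := rfl

theorem toFun_neg (f : BV) : (-f).toFun = -f.toFun := rfl

theorem toFun_sub (f g : BV) : (f - g).toFun = f.toFun - g.toFun := rfl

/-- The limit at `-∞` is a genuine limit for functions of bounded variation. -/
theorem tendsto_limAtBot (f : BV) : Tendsto f atBot (𝓝 (limAtBot f)) :=
  f.boundedVariationOn.tendsto_atBot_limUnder

/-- The norm `|f(-∞)| + Var(f)`. -/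
noncomputable def bvNorm : AddGroupNorm BV where
  toFun f := |limAtBot f| + totalVar f
  map_zero' := by
    have h : limAtBot (0 : BV) = 0 :=
      (tendsto_limAtBot 0).limUnder_eq.symm.trans
        (tendsto_const_nhds : Tendsto (fun _ : ℝ => (0 : ℝ)) atBot (𝓝 0)).limUnder_eq
    rw [h]
    simp [totalVar, toFun_zero, eVariationOn_zero]
  add_le' f g := by
    have h : limAtBot (f + g : BV) = limAtBot f + limAtBot g :=
      ((tendsto_limAtBot f).add (tendsto_limAtBot g)).limUnder_eq
    have hv : totalVar (f + g : BV) ≤ totalVar f + totalVar g := by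
      unfold totalVar
      rw [← ENNReal.toReal_add f.boundedVariationOn g.boundedVariationOn]
      exact ENNReal.toReal_mono
        (ENNReal.add_ne_top.2 ⟨f.boundedVariationOn, g.boundedVariationOn⟩)
        (eVariationOn_add_le f g _)
    rw [h]
    linarith [abs_add_le (limAtBot f) (limAtBot g)]
  neg' f := by
    have h : limAtBot (-f : BV) = -limAtBot f := (tendsto_limAtBot f).neg.limUnder_eq
    have hv : totalVar (-f : BV) = totalVar f := by
      simp only [totalVar, toFun_neg, eVariationOn_neg]
    rw [h, hv, abs_neg]
  eq_zero_of_map_eq_zero' f hf := by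
    have h1 : 0 ≤ totalVar f := ENNReal.toReal_nonneg
    have h2 := abs_nonneg (limAtBot f)
    have hv : eVariationOn f Set.univ = 0 :=
      ((ENNReal.toReal_eq_zero_iff _).1 (show totalVar f = 0 by linarith)).resolve_right
        f.boundedVariationOn
    have hl : limAtBot f = 0 := abs_eq_zero.1 (by linarith)
    have hc : ∀ x y, f x = f y := fun x y =>
      edist_eq_zero.1 ((eVariationOn.eq_zero_iff _).1 hv x trivial y trivial)
    refine ext (funext fun x => ?_)
    have h3 : Tendsto f atBot (𝓝 (f x)) :=
      tendsto_const_nhds.congr fun y => hc x y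
    rw [toFun_zero, Pi.zero_apply, ← hl]
    exact tendsto_nhds_unique h3 f.tendsto_limAtBot

noncomputable instance : NormedAddCommGroup BV := bvNorm.toNormedAddCommGroup

theorem norm_def (f : BV) : ‖f‖ = |limAtBot f| + totalVar f := rfl

/-- Functions of bounded variation are measurable. -/
theorem measurable (f : BV) : Measurable f := by
  obtain ⟨p, q, hp, hq, h⟩ :=
    f.boundedVariationOn.locallyBoundedVariationOn.exists_monotoneOn_sub_monotoneOn
  rw [h]
  exact (monotoneOn_univ.1 hp).measurable.sub (monotoneOn_univ.1 hq).measurable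

/-- Functions of bounded variation are bounded. -/
theorem abs_le (f : BV) (x : ℝ) : |f x| ≤ |f 0| + totalVar f := by
  have h := f.boundedVariationOn.dist_le (Set.mem_univ x) (Set.mem_univ 0)
  rw [Real.dist_eq] at h
  have h2 := abs_sub_abs_le_abs_sub (f x) (f 0)
  unfold totalVar
  linarith

/-- The averages in the definition of the maximal function are averages of an integrable
function. -/
theorem integrableOn_abs (f : BV) (a b : ℝ) :
    IntegrableOn (fun t => |f t|) (Set.Ioo a b) :=
  Measure.integrableOn_of_bounded (M := |f 0| + totalVar f) (by simp)
    f.measurable.abs.aestronglyMeasurable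
    (ae_of_all _ fun t => by simpa using f.abs_le t)

/-- For functions of bounded variation the supremum defining the maximal function is a genuine,
finite supremum of averages. -/
theorem isLUB_uncenteredMaximal (f : BV) (x : ℝ) :
    IsLUB {y | ∃ a b : ℝ, a < x ∧ x < b ∧ y = (b - a)⁻¹ * ∫ t in a..b, |f t|}
      (uncenteredMaximal f x) := by
  have key : ∀ a b : ℝ, a < b →
      ⨍ t in Set.Ioo a b, |f t| = (b - a)⁻¹ * ∫ t in a..b, |f t| := by
    intro a b hab
    rw [setAverage_eq, intervalIntegral.integral_of_le hab.le, integral_Ioc_eq_integral_Ioo,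
      measureReal_def, Real.volume_Ioo, ENNReal.toReal_ofReal (by linarith), smul_eq_mul]
  have hset : {y | ∃ a b : ℝ, a < x ∧ x < b ∧ y = (b - a)⁻¹ * ∫ t in a..b, |f t|} =
      Set.range (fun I : {I : ℝ × ℝ // x ∈ Set.Ioo I.1 I.2} =>
        ⨍ t in Set.Ioo I.1.1 I.1.2, |f t|) := by
    ext y
    constructor
    · rintro ⟨a, b, ha, hb, rfl⟩
      exact ⟨⟨(a, b), ha, hb⟩, key a b (ha.trans hb)⟩
    · rintro ⟨⟨⟨a, b⟩, ha, hb⟩, rfl⟩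
      exact ⟨a, b, ha, hb, key a b (lt_trans ha hb)⟩
  rw [hset]
  have : Nonempty {I : ℝ × ℝ // x ∈ Set.Ioo I.1 I.2} := ⟨⟨(x - 1, x + 1), by simp⟩⟩
  refine isLUB_ciSup ⟨|f 0| + totalVar f, ?_⟩
  rintro _ ⟨⟨⟨a, b⟩, ha, hb⟩, rfl⟩
  have hab : a < b := lt_trans ha hb
  change ⨍ t in Set.Ioo a b, |f t| ≤ _
  have h1 : ∫ t in Set.Ioo a b, |f t| ≤ ∫ _ in Set.Ioo a b, (|f 0| + totalVar f) :=
    setIntegral_mono (f.integrableOn_abs a b) (by simp) fun t => f.abs_le t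
  rw [setAverage_eq, smul_eq_mul]
  rw [setIntegral_const, smul_eq_mul] at h1
  have hpos : 0 < volume.real (Set.Ioo a b) := by
    rw [measureReal_def, Real.volume_Ioo, ENNReal.toReal_ofReal (by linarith)]
    linarith
  rwa [inv_mul_le_iff₀ hpos]

end BV

end BVMax

/-! Write U for the maximal function of f and U_j for that of F_j. Maximal functions are absolutely
continuous, so their variation is the L¹ norm of the derivative. L¹ convergence of U_j' then follows
from a Riesz–Scheffé argument (`tendsto_lintegral_enorm_sub_of_le`) with two inputs: convergence of
U_j' almost everywhere where U' ≠ 0, and upper semicontinuity of Var(U_j). It suffices to argue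
along subsequences. The limit at -∞ is harmless because |U - U_j| ≤ sup |f - F_j| ≤ ‖f - F_j‖.

Upper semicontinuity is proved level by level. On a countable dense set D of common continuity
points, the coarea formula `lintegral_levelVar` writes a variation as the integral over c of the
variation of the indicator of {h > c}. Each component of {U > c} contains a point of D with |f| > c,
so passing to the maximal function creates no new jumps, and Var(U) ≤ Var(f). Norm convergence makes
the excess level variations of ±F_j vanish in mean, hence for almost every c along a subsequence.
For such c one finite set meets every component of {U_j > c} for all large j, and uniform
convergence U_j → U then shows that {U_j > c} has no more jumps than {U > c}
(`eventually_levelVar_uncenteredMaximal_le`).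

For regularity, near a point of the detached set only intervals of length bounded below compete, so
U is locally Lipschitz there; the rest of the line has a null image under U. The intermediate value
theorem and the area inequality bound |U(b) - U(a)| by the integral of |U'| over the detached part
of (a, b] (`edist_uncenteredMaximal_le`). This gives absolute continuity, and U' = 0 almost
everywhere off the detached set.

On the detached set some interval between x and x + 1/r, or a half-line when r = 0, is optimal, and
U'(x) = (U(x) - |f(x)|) r (`IsNearOptimal.deriv_eq`). The optimal r for F_j stay bounded and their
limit points are optimal for f, so the formula passes to the limit. -/

open scoped ENNReal

namespace BVMax

/-! ### Superlevel sets and the coarea formula on countable sets -/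

/-- The variation over `D` of the indicator function of the superlevel set `{h > c}`. -/
noncomputable def levelVar (D : Set ℝ) (h : ℝ → ℝ) (c : ℝ) : ℝ≥0∞ :=
  eVariationOn ({x | c < h x}.indicator (1 : ℝ → ℝ)) D

theorem eVariationOn_insert_of_isGreatest (f : ℝ → ℝ) {S : Set ℝ} {m a : ℝ}
    (hm : IsGreatest S m) (ha : m < a) :
    eVariationOn f (insert a S) = eVariationOn f S + edist (f m) (f a) := by
  have h1 : IsLeast ({m, a} : Set ℝ) m :=
    ⟨by simp, by rintro x (rfl | rfl); exacts [le_rfl, ha.le]⟩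
  rw [← eVariationOn.pair, ← eVariationOn.union f hm h1]
  congr 1
  ext x
  simp only [Set.mem_insert_iff, Set.mem_union, Set.mem_singleton_iff]
  constructor
  · rintro (h | h) <;> simp [h]
  · rintro (h | h | h)
    exacts [Or.inr h, Or.inr (h ▸ hm.1), Or.inl h]

theorem edist_indicator_superlevel (h : ℝ → ℝ) (x y c : ℝ) :
    edist ({x | c < h x}.indicator (1 : ℝ → ℝ) x) ({x | c < h x}.indicator (1 : ℝ → ℝ) y) =
      (Set.Ico (min (h x) (h y)) (max (h x) (h y))).indicator (1 : ℝ → ℝ≥0∞) c := by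
  by_cases hx : c < h x <;> by_cases hy : c < h y
  · have : ¬ (h x ≤ c ∨ h y ≤ c) := by simp [hx, hy]
    simp [Set.indicator, hx, hy, this]
  · simp [Set.indicator, hx, hy, not_lt.1 hy]
  · simp [Set.indicator, hx, hy, not_lt.1 hx]
  · simp [Set.indicator, hx, hy]

theorem lintegral_edist_indicator_superlevel (h : ℝ → ℝ) (x y : ℝ) :
    ∫⁻ c, edist ({x | c < h x}.indicator (1 : ℝ → ℝ) x)
      ({x | c < h x}.indicator (1 : ℝ → ℝ) y) = edist (h x) (h y) := by
  simp_rw [edist_indicator_superlevel]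
  rw [lintegral_indicator_one measurableSet_Ico, Real.volume_Ico, max_sub_min_eq_abs, edist_dist,
    Real.dist_eq, abs_sub_comm]

theorem measurable_edist_indicator_superlevel (h : ℝ → ℝ) (x y : ℝ) :
    Measurable fun c : ℝ => edist ({x | c < h x}.indicator (1 : ℝ → ℝ) x)
      ({x | c < h x}.indicator (1 : ℝ → ℝ) y) := by
  simp_rw [edist_indicator_superlevel]
  exact measurable_one.indicator measurableSet_Ico

/-- For two points this is the length of the interval of levels separating the two values. A new
largest point contributes exactly one further two-point term to every variation involved, so
induction applies. -/
theorem levelVar_finset (h : ℝ → ℝ) (S : Finset ℝ) :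
    Measurable (levelVar S h) ∧ ∫⁻ c, levelVar S h c = eVariationOn h S := by
  induction S using Finset.induction_on_max with
  | empty =>
    have : levelVar ((∅ : Finset ℝ) : Set ℝ) h = fun _ => 0 := by
      ext c; simp [levelVar]
    rw [this]; simp
  | insert a S ha ih =>
    rcases S.eq_empty_or_nonempty with rfl | hS
    · have : levelVar ((insert a (∅ : Finset ℝ) : Finset ℝ) : Set ℝ) h = fun _ => 0 := by
        ext c; simp [levelVar]
      rw [this]; simp
    · have hm : IsGreatest (S : Set ℝ) (S.max' hS) := S.isGreatest_max' hS
      have hlt := ha _ (S.max'_mem hS)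
      have : levelVar ((insert a S : Finset ℝ) : Set ℝ) h = fun c => levelVar S h c +
          edist ({x | c < h x}.indicator (1 : ℝ → ℝ) (S.max' hS))
            ({x | c < h x}.indicator (1 : ℝ → ℝ) a) := by
        ext c
        rw [levelVar, Finset.coe_insert, eVariationOn_insert_of_isGreatest _ hm hlt, levelVar]
      rw [this]
      refine ⟨ih.1.add (measurable_edist_indicator_superlevel h _ _), ?_⟩
      rw [lintegral_add_left ih.1, ih.2, lintegral_edist_indicator_superlevel, Finset.coe_insert,
        eVariationOn_insert_of_isGreatest _ hm hlt]

/-- A variation sum involves finitely many points, which all lie in a single member of the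
increasing family. -/
theorem eVariationOn_iUnion_of_monotone (f : ℝ → ℝ) {S : ℕ → Set ℝ} (hS : Monotone S) :
    eVariationOn f (⋃ n, S n) = ⨆ n, eVariationOn f (S n) := by
  refine le_antisymm (iSup_le ?_) (iSup_le fun n => eVariationOn.mono f (Set.subset_iUnion S n))
  rintro ⟨n, u, hu, us⟩
  choose k hk using fun i => Set.mem_iUnion.1 (us i)
  let K := (Finset.range (n + 1)).sup k
  refine le_trans ?_ (le_iSup _ K)
  refine eVariationOn.sum_le_of_monotoneOn_Iic (hu.monotoneOn _) fun i hi => ?_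
  exact hS (Finset.le_sup (f := k) (Finset.mem_range.2 (Nat.lt_succ_of_le hi))) (hk i)

theorem exists_monotone_finset_iUnion {D : Set ℝ} (hD : D.Countable) :
    ∃ S : ℕ → Finset ℝ, Monotone (fun n => (S n : Set ℝ)) ∧ ⋃ n, (S n : Set ℝ) = D := by
  classical
  rcases D.eq_empty_or_nonempty with rfl | hne
  · exact ⟨fun _ => ∅, fun _ _ _ => le_rfl, by simp⟩
  obtain ⟨e, rfl⟩ := hD.exists_eq_range hne
  refine ⟨fun n => (Finset.range n).image e, fun m n hmn => ?_, ?_⟩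
  · exact_mod_cast Finset.image_subset_image (Finset.range_mono hmn)
  · ext x
    simp only [Finset.coe_image, Finset.coe_range, Set.mem_iUnion, Set.mem_image, Set.mem_Iio,
      Set.mem_range]
    exact ⟨fun ⟨_, k, _, h⟩ => ⟨k, h⟩, fun ⟨k, h⟩ => ⟨k + 1, k, Nat.lt_succ_self k, h⟩⟩

theorem measurable_levelVar {D : Set ℝ} (hD : D.Countable) (h : ℝ → ℝ) :
    Measurable (levelVar D h) := by
  obtain ⟨S, hS, rfl⟩ := exists_monotone_finset_iUnion hD
  have : levelVar (⋃ n, (S n : Set ℝ)) h = fun c => ⨆ n, levelVar (S n) h c := by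
    ext c; exact eVariationOn_iUnion_of_monotone _ hS
  rw [this]
  exact Measurable.iSup fun n => (levelVar_finset h (S n)).1

/-- The coarea formula on a countable subset of the line. -/
theorem lintegral_levelVar {D : Set ℝ} (hD : D.Countable) (h : ℝ → ℝ) :
    ∫⁻ c, levelVar D h c = eVariationOn h D := by
  obtain ⟨S, hS, rfl⟩ := exists_monotone_finset_iUnion hD
  have : levelVar (⋃ n, (S n : Set ℝ)) h = fun c => ⨆ n, levelVar (S n) h c := by
    ext c; exact eVariationOn_iUnion_of_monotone _ hS
  rw [this, lintegral_iSup (fun n => (levelVar_finset h (S n)).1)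
    fun m n hmn c => eVariationOn.mono _ (hS hmn), eVariationOn_iUnion_of_monotone h hS]
  exact iSup_congr fun n => (levelVar_finset h (S n)).2

/-! ### Mean convergence of level variations -/

/-- When c is not a value of f on D, the indicators of the superlevel sets converge pointwise on D,
and variation is lower semicontinuous under pointwise convergence. Subtraction is truncated, so only
the deficit is controlled here. -/
theorem levelVar_tendsto_sub_zero {D : Set ℝ} {F : ℕ → ℝ → ℝ} {f : ℝ → ℝ}
    (hconv : ∀ x ∈ D, Tendsto (fun j => F j x) atTop (𝓝 (f x))) {c : ℝ} (hc : c ∉ f '' D)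
    (hfin : levelVar D f c ≠ ∞) :
    Tendsto (fun j => levelVar D f c - levelVar D (F j) c) atTop (𝓝 0) := by
  have hind : ∀ x ∈ D, Tendsto (fun j => {x | c < F j x}.indicator (1 : ℝ → ℝ) x) atTop
      (𝓝 ({x | c < f x}.indicator (1 : ℝ → ℝ) x)) := by
    intro x hx
    refine tendsto_const_nhds.congr' ?_
    rcases lt_or_gt_of_ne (fun h : c = f x => hc ⟨x, hx, h.symm⟩) with h | h
    · filter_upwards [(hconv x hx).eventually_const_lt h] with j hj
      simp [Set.indicator, h, hj]
    · filter_upwards [(hconv x hx).eventually_lt_const h] with j hj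
      simp [Set.indicator, h.not_gt, hj.not_gt]
  rw [ENNReal.tendsto_atTop_zero]
  intro ε hε
  rcases eq_or_ne (levelVar D f c) 0 with h0 | h0
  · exact ⟨0, fun j _ => by simp [h0]⟩
  have hlt : levelVar D f c - ε < levelVar D f c := ENNReal.sub_lt_self hfin h0 hε.ne'
  have := eVariationOn.lowerSemicontinuous_aux hind hlt
  obtain ⟨N, hN⟩ := eventually_atTop.1 this
  exact ⟨N, fun j hj => by
    rw [tsub_le_iff_left, ← tsub_le_iff_right]; exact (hN j hj).le⟩

/-- Convergence of the variations forces convergence in mean of the variations of the superlevel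
sets. -/
theorem tendsto_lintegral_levelVar_sub {D : Set ℝ} (hD : D.Countable) {F : ℕ → ℝ → ℝ} {f : ℝ → ℝ}
    (hconv : ∀ x ∈ D, Tendsto (fun j => F j x) atTop (𝓝 (f x)))
    (hvar : Tendsto (fun j => eVariationOn (F j) D) atTop (𝓝 (eVariationOn f D)))
    (hfin : eVariationOn f D ≠ ∞) :
    Tendsto (fun j => ∫⁻ c, (levelVar D (F j) c - levelVar D f c)) atTop (𝓝 0) := by
  have hm := fun h => measurable_levelVar hD h
  have hfin' : ∫⁻ c, levelVar D f c ≠ ∞ := by rwa [lintegral_levelVar hD]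
  have h1 : Tendsto (fun j => ∫⁻ c, (levelVar D f c - levelVar D (F j) c)) atTop (𝓝 0) := by
    have := tendsto_lintegral_of_dominated_convergence
      (F := fun j c => levelVar D f c - levelVar D (F j) c) (f := fun _ => 0) (levelVar D f)
      (μ := volume) (fun j => (hm f).sub (hm _)) (fun j => ae_of_all _ fun c => tsub_le_self)
      hfin' ?_
    · simpa using this
    · filter_upwards [ae_lt_top (hm f) hfin', (hD.image f).ae_notMem volume] with c h1 h2
      exact levelVar_tendsto_sub_zero hconv h2 h1.ne
  -- The excess is recovered from the deficit: adding either truncated difference to the function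
  -- subtracted in it gives the same pointwise maximum, and the integrals of the level variations
  -- are known from the coarea formula.
  have h2 : ∀ j, ∫⁻ c, (levelVar D (F j) c - levelVar D f c) =
      (eVariationOn (F j) D + ∫⁻ c, (levelVar D f c - levelVar D (F j) c)) -
        eVariationOn f D := by
    intro j
    rw [← lintegral_levelVar hD, ← lintegral_levelVar hD, ← lintegral_add_left (hm _)]
    simp_rw [add_tsub_eq_max]
    have h3 : ∀ c, max (levelVar D (F j) c) (levelVar D f c) =
        levelVar D f c + (levelVar D (F j) c - levelVar D f c) := fun c => by
      rw [add_tsub_eq_max, max_comm]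
    simp_rw [h3]
    rw [lintegral_add_left (hm _), ENNReal.add_sub_cancel_left hfin']
  simp_rw [h2]
  have := ENNReal.Tendsto.sub (hvar.add h1) (tendsto_const_nhds (x := eVariationOn f D))
    (Or.inr hfin)
  simpa using this

/-- Choosing integrals at most 2⁻ᵏ makes the series of the functions integrable, so it is finite
almost everywhere and its terms tend to zero. -/
theorem exists_subseq_ae_tendsto_zero {α : Type*} [MeasurableSpace α] {μ : Measure α}
    {H : ℕ → α → ℝ≥0∞} (hm : ∀ j, Measurable (H j))
    (h : Tendsto (fun j => ∫⁻ c, H j c ∂μ) atTop (𝓝 0)) :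
    ∃ φ : ℕ → ℕ, StrictMono φ ∧ ∀ᵐ c ∂μ, Tendsto (fun k => H (φ k) c) atTop (𝓝 0) := by
  have h2 : ∀ k : ℕ, ∀ᶠ j in atTop, ∫⁻ c, H j c ∂μ ≤ 2⁻¹ ^ k := fun k =>
    (h.eventually_lt_const (ENNReal.pow_pos (by simp) k)).mono fun _ h => h.le
  obtain ⟨φ, hφ, hk⟩ := extraction_forall_of_eventually h2
  refine ⟨φ, hφ, ?_⟩
  have h3 : ∫⁻ c, ∑' k, H (φ k) c ∂μ ≠ ∞ := by
    rw [lintegral_tsum fun k => (hm _).aemeasurable]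
    refine ne_top_of_le_ne_top ?_ (ENNReal.tsum_le_tsum hk)
    rw [ENNReal.tsum_geometric]
    simp
  filter_upwards [ae_lt_top (Measurable.tsum fun k => hm _) h3] with c hc
  exact ENNReal.tendsto_atTop_zero_of_tsum_ne_top hc.ne

/-! ### Basic estimates and continuity of the maximal function -/

namespace BV

theorem abs_le_norm (f : BV) (x : ℝ) : |f x| ≤ ‖f‖ := by
  have h : |f x - limAtBot f| ≤ totalVar f := by
    have h1 : Tendsto (fun y => |f x - f y|) atBot (𝓝 |f x - limAtBot f|) :=
      (tendsto_const_nhds.sub f.tendsto_limAtBot).abs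
    refine le_of_tendsto h1 (Eventually.of_forall fun y => ?_)
    have h := f.boundedVariationOn.dist_le (Set.mem_univ x) (Set.mem_univ y)
    rwa [Real.dist_eq] at h
  rw [norm_def]
  have h2 := abs_add_le (f x - limAtBot f) (limAtBot f)
  rw [sub_add_cancel] at h2
  linarith

theorem abs_sub_le_norm (f g : BV) (x : ℝ) : |f x - g x| ≤ ‖f - g‖ :=
  abs_le_norm (f - g) x

theorem intervalIntegrable_abs (f : BV) (a b : ℝ) :
    IntervalIntegrable (fun t => |f t|) volume a b := by
  rw [intervalIntegrable_iff, Set.uIoc]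
  exact (f.integrableOn_abs (min a b) (max a b)).congr_set_ae Ioo_ae_eq_Ioc.symm

theorem integral_le_of_mem_Ioo (f : BV) {a b x : ℝ} (ha : a < x) (hb : x < b) :
    ∫ t in a..b, |f t| ≤ (b - a) * uncenteredMaximal f x := by
  have := (f.isLUB_uncenteredMaximal x).1 ⟨a, b, ha, hb, rfl⟩
  rwa [inv_mul_le_iff₀ (by linarith)] at this

theorem exists_lt_integral (f : BV) {c x : ℝ} (hc : c < uncenteredMaximal f x) :
    ∃ a b : ℝ, a < x ∧ x < b ∧ (b - a) * c < ∫ t in a..b, |f t| := by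
  obtain ⟨_, ⟨a, b, ha, hb, rfl⟩, h, -⟩ := (f.isLUB_uncenteredMaximal x).exists_between hc
  refine ⟨a, b, ha, hb, ?_⟩
  rwa [lt_inv_mul_iff₀ (by linarith)] at h

theorem uncenteredMaximal_nonneg (f : BV) (x : ℝ) : 0 ≤ uncenteredMaximal f x := by
  have h := f.integral_le_of_mem_Ioo (sub_one_lt x) (lt_add_one x)
  have h2 : 0 ≤ ∫ t in (x - 1)..(x + 1), |f t| :=
    intervalIntegral.integral_nonneg (by linarith) fun t _ => abs_nonneg _
  nlinarith

theorem uncenteredMaximal_le_of_forall (f : BV) {x c : ℝ}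
    (h : ∀ a b : ℝ, a < x → x < b → ∫ t in a..b, |f t| ≤ (b - a) * c) :
    uncenteredMaximal f x ≤ c := by
  by_contra! hc
  obtain ⟨a, b, ha, hb, hab⟩ := f.exists_lt_integral hc
  exact absurd (h a b ha hb) hab.not_ge

/-- An interval near `y` yields a lower bound for the maximal function at `y`. -/
theorem integral_le_add (f : BV) {a b x : ℝ} (ha : a ≤ x) (hb : x ≤ b) (y : ℝ) :
    ∫ t in a..b, |f t| ≤ (b - a + |x - y|) * uncenteredMaximal f y := by
  have h1 : ∀ ε > 0, ∫ t in a..b, |f t| ≤ (b - a + |x - y| + 2 * ε) * uncenteredMaximal f y := by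
    intro ε hε
    have hmin : min a y ≤ a := min_le_left _ _
    have hmin' : min a y ≤ y := min_le_right _ _
    have hmax : b ≤ max b y := le_max_left _ _
    have hmax' : y ≤ max b y := le_max_right _ _
    have h2 := f.integral_le_of_mem_Ioo (a := min a y - ε) (b := max b y + ε) (x := y)
      (by linarith) (by linarith)
    have h3 : ∫ t in a..b, |f t| ≤ ∫ t in (min a y - ε)..(max b y + ε), |f t| :=
      intervalIntegral.integral_mono_interval (by linarith) (by linarith) (by linarith)
        (ae_of_all _ fun t => abs_nonneg _) (f.intervalIntegrable_abs _ _)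
    have h4 : max b y - min a y ≤ b - a + |x - y| := by
      rcases le_total a y with h | h <;> rcases le_total b y with h' | h'
      · rw [max_eq_right h', min_eq_left h]; linarith [neg_abs_le (x - y)]
      · rw [max_eq_left h', min_eq_left h]; linarith [abs_nonneg (x - y)]
      · rw [max_eq_right h', min_eq_right h]; linarith [abs_nonneg (x - y)]
      · rw [max_eq_left h', min_eq_right h]; linarith [le_abs_self (x - y)]
    nlinarith [f.uncenteredMaximal_nonneg y]
  have h2 : Tendsto (fun ε : ℝ => (b - a + |x - y| + 2 * ε) * uncenteredMaximal f y) (𝓝[>] 0)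
      (𝓝 ((b - a + |x - y| + 2 * 0) * uncenteredMaximal f y)) :=
    Tendsto.mono_left (Continuous.tendsto (by fun_prop) 0) nhdsWithin_le_nhds
  simpa using ge_of_tendsto h2 (eventually_mem_nhdsWithin.mono fun ε hε => h1 ε hε)

theorem integral_le (f : BV) {a b x : ℝ} (ha : a ≤ x) (hb : x ≤ b) :
    ∫ t in a..b, |f t| ≤ (b - a) * uncenteredMaximal f x := by
  simpa using f.integral_le_add ha hb x

theorem uncenteredMaximal_le (f : BV) {K : ℝ} (hK : ∀ t, |f t| ≤ K) (x : ℝ) :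
    uncenteredMaximal f x ≤ K := by
  refine f.uncenteredMaximal_le_of_forall fun a b ha hb => ?_
  have := intervalIntegral.integral_mono (ha.trans hb).le (f.intervalIntegrable_abs a b)
    intervalIntegrable_const hK
  simpa using this

theorem uncenteredMaximal_le_add (f g : BV) {ε : ℝ} (h : ∀ t, |f t - g t| ≤ ε) (x : ℝ) :
    uncenteredMaximal f x ≤ uncenteredMaximal g x + ε := by
  refine f.uncenteredMaximal_le_of_forall fun a b ha hb => ?_
  have h1 : ∫ t in a..b, |f t| ≤ ∫ t in a..b, (|g t| + ε) :=
    intervalIntegral.integral_mono (ha.trans hb).le (f.intervalIntegrable_abs a b)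
      ((g.intervalIntegrable_abs a b).add intervalIntegrable_const) fun t => by
        have := abs_sub_abs_le_abs_sub (f t) (g t)
        have := h t
        simp only []
        linarith
  rw [intervalIntegral.integral_add (g.intervalIntegrable_abs a b) intervalIntegrable_const] at h1
  have h2 := g.integral_le ha.le hb.le
  simp only [intervalIntegral.integral_const, smul_eq_mul] at h1
  linarith

theorem abs_uncenteredMaximal_sub_le (f g : BV) {ε : ℝ} (h : ∀ t, |f t - g t| ≤ ε) (x : ℝ) :
    |uncenteredMaximal f x - uncenteredMaximal g x| ≤ ε := by
  rw [abs_sub_le_iff]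
  exact ⟨by linarith [uncenteredMaximal_le_add f g h x], by
    linarith [uncenteredMaximal_le_add g f (fun t => abs_sub_comm (f t) (g t) ▸ h t) x]⟩

theorem mul_le_integral {f : BV} {a b c : ℝ} (hab : a ≤ b)
    (h : ∀ᵐ t, t ∈ Set.Ioo a b → c ≤ |f t|) : (b - a) * c ≤ ∫ t in a..b, |f t| := by
  have h1 : ∫ _ in a..b, c ≤ ∫ t in a..b, |f t| := by
    rw [intervalIntegral.integral_of_le hab, intervalIntegral.integral_of_le hab,
      integral_Ioc_eq_integral_Ioo, integral_Ioc_eq_integral_Ioo]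
    refine setIntegral_mono_on_ae (by simp) (f.integrableOn_abs a b) measurableSet_Ioo h
  simpa using h1

theorem integral_le_mul {f : BV} {a b c : ℝ} (hab : a ≤ b)
    (h : ∀ᵐ t, t ∈ Set.Ioo a b → |f t| ≤ c) : ∫ t in a..b, |f t| ≤ (b - a) * c := by
  have h1 : ∫ t in a..b, |f t| ≤ ∫ _ in a..b, c := by
    rw [intervalIntegral.integral_of_le hab, intervalIntegral.integral_of_le hab,
      integral_Ioc_eq_integral_Ioo, integral_Ioc_eq_integral_Ioo]
    refine setIntegral_mono_on_ae (f.integrableOn_abs a b) (by simp) measurableSet_Ioo h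
  simpa using h1

theorem le_uncenteredMaximal_of_ae {f : BV} {a b c x : ℝ} (hab : a < b) (ha : a ≤ x) (hb : x ≤ b)
    (h : ∀ᵐ t, t ∈ Set.Ioo a b → c ≤ |f t|) : c ≤ uncenteredMaximal f x := by
  have h1 := mul_le_integral hab.le h
  have h2 := f.integral_le ha hb
  have : 0 < b - a := by linarith
  nlinarith

theorem abs_le_uncenteredMaximal_of_tendsto_right {f : BV} {x l : ℝ}
    (h : Tendsto f (𝓝[>] x) (𝓝 l)) : |l| ≤ uncenteredMaximal f x := by
  refine le_of_forall_lt fun c hc => ?_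
  obtain ⟨c', hc', hc''⟩ := exists_between hc
  have h1 := h.abs.eventually_const_lt hc''
  obtain ⟨b, hb, hxb⟩ := mem_nhdsGT_iff_exists_Ioo_subset.1 h1
  exact hc'.trans_le (le_uncenteredMaximal_of_ae hb le_rfl (le_of_lt hb)
    (ae_of_all _ fun t ht => (hxb ht).le))

theorem abs_le_uncenteredMaximal_of_tendsto_left {f : BV} {x l : ℝ}
    (h : Tendsto f (𝓝[<] x) (𝓝 l)) : |l| ≤ uncenteredMaximal f x := by
  refine le_of_forall_lt fun c hc => ?_
  obtain ⟨c', hc', hc''⟩ := exists_between hc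
  have h1 := h.abs.eventually_const_lt hc''
  obtain ⟨a, ha, hxa⟩ := mem_nhdsLT_iff_exists_Ioo_subset.1 h1
  exact hc'.trans_le (le_uncenteredMaximal_of_ae ha (le_of_lt ha) le_rfl
    (ae_of_all _ fun t ht => (hxa ht).le))

theorem abs_le_uncenteredMaximal {f : BV} {x : ℝ} (h : ContinuousAt f x) :
    |f x| ≤ uncenteredMaximal f x :=
  abs_le_uncenteredMaximal_of_tendsto_right (h.tendsto.mono_left nhdsWithin_le_nhds)

/-- One-sided averages show that the maximal function dominates both one-sided limits of |f|. The
point itself must be removed, since the value there is invisible to averages. -/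
theorem eventually_abs_lt (f : BV) {x c : ℝ} (hc : uncenteredMaximal f x < c) :
    ∀ᶠ t in 𝓝[≠] x, |f t| < c := by
  obtain ⟨l, hl⟩ := f.boundedVariationOn.exists_tendsto_left x
  obtain ⟨r, hr⟩ := f.boundedVariationOn.exists_tendsto_right x
  rw [Set.univ_inter] at hl hr
  rw [← Set.Iio_union_Ioi, nhdsWithin_union, eventually_sup]
  exact ⟨hl.abs.eventually_lt_const ((abs_le_uncenteredMaximal_of_tendsto_left hl).trans_lt hc),
    hr.abs.eventually_lt_const ((abs_le_uncenteredMaximal_of_tendsto_right hr).trans_lt hc)⟩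

/-- Where `|f|` is locally below `c`, only long intervals contribute to values of the maximal
function above `c`. -/
theorem uncenteredMaximal_le_max (f : BV) {x c η : ℝ} (hη : 0 < η)
    (h : ∀ᵐ t, |t - x| < η → |f t| ≤ c) {y : ℝ} (hy : |y - x| < η / 2) (z : ℝ) :
    uncenteredMaximal f y ≤ max c ((1 + 2 * |y - z| / η) * uncenteredMaximal f z) := by
  refine f.uncenteredMaximal_le_of_forall fun a b ha hb => ?_
  rw [abs_lt] at hy
  by_cases hab : x - η ≤ a ∧ b ≤ x + η
  · refine (integral_le_mul (ha.trans hb).le (h.mono fun t ht hab' => ht ?_)).trans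
      (mul_le_mul_of_nonneg_left (le_max_left _ _) (by linarith))
    rw [abs_lt]
    exact ⟨by linarith [hab'.1], by linarith [hab'.2]⟩
  -- An interval that contains y, within η/2 of x, and leaves the η-neighbourhood of x has length at
  -- least η/2. Enlarging it to reach z then costs a factor of at most 1 + 2|y - z|/η.
  · have hlen : η / 2 ≤ b - a := by
      by_contra! hlt
      exact hab ⟨by linarith, by linarith⟩
    refine (f.integral_le_add ha.le hb.le z).trans
      (le_trans ?_ (mul_le_mul_of_nonneg_left (le_max_right _ _) (by linarith)))
    rw [← mul_assoc]
    refine mul_le_mul_of_nonneg_right ?_ (f.uncenteredMaximal_nonneg z)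
    have : |y - z| ≤ (b - a) * (2 * |y - z| / η) := by
      rw [mul_div_assoc', le_div_iff₀ hη]
      nlinarith [abs_nonneg (y - z)]
    linarith

theorem exists_ae_le_of_lt (f : BV) {x c : ℝ} (hc : uncenteredMaximal f x < c) :
    ∃ η > 0, ∀ᵐ t, |t - x| < η → |f t| ≤ c := by
  obtain ⟨η, hη, h⟩ := Metric.mem_nhdsWithin_iff.1 (f.eventually_abs_lt hc)
  refine ⟨η, hη, (measure_singleton x : volume {x} = 0) |> measure_eq_zero_iff_ae_notMem.1
    |>.mono fun t ht htx => ?_⟩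
  exact (h ⟨by rwa [Metric.mem_ball, Real.dist_eq], ht⟩ : |f t| < c).le

/-- Lower semicontinuity: a good interval for x is good for all of its points. Upper semicontinuity:
above a level exceeding the value at x only long intervals matter, and these can be enlarged to
contain x at little cost. -/
theorem continuous_uncenteredMaximal (f : BV) : Continuous (uncenteredMaximal f) := by
  refine continuous_iff_continuousAt.2 fun x => ?_
  refine tendsto_order.2 ⟨fun c hc => ?_, fun c hc => ?_⟩
  · obtain ⟨a, b, ha, hb, h⟩ := f.exists_lt_integral hc
    filter_upwards [Ioo_mem_nhds ha hb] with y hy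
    have := f.integral_le hy.1.le hy.2.le
    exact lt_of_mul_lt_mul_left (h.trans_le this) (by linarith)
  · obtain ⟨c', h1, h2⟩ := exists_between hc
    obtain ⟨η, hη, h⟩ := f.exists_ae_le_of_lt h1
    have h3 : Tendsto (fun y => (1 + 2 * |y - x| / η) * uncenteredMaximal f x) (𝓝 x)
        (𝓝 ((1 + 2 * |x - x| / η) * uncenteredMaximal f x)) :=
      Continuous.tendsto (by fun_prop) x
    rw [sub_self, abs_zero, mul_zero, zero_div, add_zero, one_mul] at h3
    filter_upwards [h3.eventually_lt_const hc, Metric.ball_mem_nhds x (half_pos hη)] with y h4 h5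
    exact (f.uncenteredMaximal_le_max hη h h5 x).trans_lt (max_lt h2 h4)

/-! ### The detached set and local Lipschitz regularity -/

/-- The set of points near which `|f|` stays essentially strictly below the value of its maximal
function. -/
def detachedSet (f : BV) : Set ℝ :=
  {x | ∃ c < uncenteredMaximal f x, ∃ η > 0, ∀ᵐ t, |t - x| < η → |f t| ≤ c}

theorem isOpen_detachedSet (f : BV) : IsOpen f.detachedSet := by
  refine isOpen_iff_mem_nhds.2 fun x ⟨c, hc, η, hη, h⟩ => ?_
  filter_upwards [f.continuous_uncenteredMaximal.continuousAt.eventually_const_lt hc,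
    Metric.ball_mem_nhds x (half_pos hη)] with y hy hyx
  refine ⟨c, hy, η / 2, half_pos hη, h.mono fun t ht hty => ht ?_⟩
  rw [Metric.mem_ball, Real.dist_eq] at hyx
  have := abs_sub_le t y x
  linarith

/-- The maximal function is locally Lipschitz on the detached set. -/
theorem exists_lipschitzOnWith (f : BV) {x : ℝ} (hx : x ∈ f.detachedSet) :
    ∃ K, ∃ s ∈ 𝓝 x, LipschitzOnWith K (uncenteredMaximal f) s := by
  obtain ⟨c, hc, η, hη, h⟩ := hx
  have hM := f.uncenteredMaximal_le f.abs_le_norm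
  refine ⟨(2 / η * ‖f‖).toNNReal, {y | c < uncenteredMaximal f y} ∩ Metric.ball x (η / 2),
    inter_mem (f.continuous_uncenteredMaximal.continuousAt.eventually_const_lt hc)
      (Metric.ball_mem_nhds x (half_pos hη)), ?_⟩
  refine LipschitzOnWith.of_le_add_mul _ fun y hy z hz => ?_
  have h1 := f.uncenteredMaximal_le_max hη h hy.2 z
  rw [le_max_iff, or_iff_right (not_le.2 hy.1)] at h1
  refine h1.trans ?_
  rw [Real.coe_toNNReal _ (by positivity), Real.dist_eq, add_mul, one_mul, add_le_add_iff_left]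
  calc 2 * |y - z| / η * uncenteredMaximal f z ≤ 2 * |y - z| / η * ‖f‖ :=
        mul_le_mul_of_nonneg_left (hM z) (by positivity)
    _ = _ := by ring

end BV

/-! ### Monotone transport of superlevel sets and the variation bound -/

/-- The comparison principle behind all level estimates: to bound the jumps of A by those of B, move
the points of D monotonically within D so that membership in A becomes membership in B. -/
theorem eVariationOn_indicator_le_of_monotoneOn {A B D : Set ℝ} {φ : ℝ → ℝ}
    (hφ : MonotoneOn φ D) (hD : Set.MapsTo φ D D) (h : ∀ x ∈ D, x ∈ A ↔ φ x ∈ B) :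
    eVariationOn (A.indicator (1 : ℝ → ℝ)) D ≤ eVariationOn (B.indicator (1 : ℝ → ℝ)) D := by
  have h1 : Set.EqOn (A.indicator (1 : ℝ → ℝ)) (B.indicator (1 : ℝ → ℝ) ∘ φ) D := fun x hx => by
    by_cases hA : x ∈ A
    · simp [hA, (h x hx).1 hA]
    · have hB : φ x ∉ B := fun hB => hA ((h x hx).2 hB)
      simp [hA, hB]
  rw [eVariationOn.congr h1]
  exact eVariationOn.comp_le_of_monotoneOn _ φ hφ hD

theorem lt_of_mem_ordConnectedComponent {A : Set ℝ} {x y z : ℝ}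
    (hy : y ∈ A.ordConnectedComponent x) (hz : z ∉ A) (hxz : x ≤ z) : y < z := by
  by_contra! h
  exact hz (hy (Set.mem_uIcc.2 (Or.inl ⟨hxz, h⟩)))

theorem gt_of_mem_ordConnectedComponent {A : Set ℝ} {x y z : ℝ}
    (hy : y ∈ A.ordConnectedComponent x) (hz : z ∉ A) (hxz : z ≤ x) : z < y := by
  by_contra! h
  exact hz (hy (Set.mem_uIcc.2 (Or.inr ⟨h, hxz⟩)))

/-- A point of `T` in the order connected component of `x` in `A`, depending only on the
component. -/
noncomputable def componentPoint (A T : Set ℝ) (x : ℝ) : ℝ :=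
  Classical.epsilon fun y => y ∈ A.ordConnectedComponent x ∩ T

theorem componentPoint_mem {A T : Set ℝ} {x : ℝ} (h : (A.ordConnectedComponent x ∩ T).Nonempty) :
    componentPoint A T x ∈ A.ordConnectedComponent x ∩ T :=
  Classical.epsilon_spec h

/-- Points of the same component share their chosen point; different components are separated by a
point outside A, which orders the choices. -/
theorem componentPoint_mono {A T : Set ℝ} {x y : ℝ} (hxy : x ≤ y)
    (hx : (A.ordConnectedComponent x ∩ T).Nonempty)
    (hy : (A.ordConnectedComponent y ∩ T).Nonempty) :
    componentPoint A T x ≤ componentPoint A T y := by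
  by_cases h : Set.uIcc x y ⊆ A
  · simp only [componentPoint, Set.ordConnectedComponent_eq h, le_refl]
  · obtain ⟨z, hz, hzA⟩ := Set.not_subset.1 h
    rw [Set.uIcc_of_le hxy] at hz
    exact (lt_of_mem_ordConnectedComponent (componentPoint_mem hx).1 hzA hz.1).le.trans
      (gt_of_mem_ordConnectedComponent (componentPoint_mem hy).1 hzA hz.2).le

/-- The identity is a pointwise limit of monotone step maps into D, one value in D for each cell of
mesh 1/(k+1). Composing with them does not raise the variation over D, and lower semicontinuity
gives the bound in the limit. -/
theorem eVariationOn_eq_of_dense {D : Set ℝ} (hD : Dense D) {h : ℝ → ℝ} (hh : Continuous h) :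
    eVariationOn h Set.univ = eVariationOn h D := by
  refine le_antisymm ?_ (eVariationOn.mono h (Set.subset_univ D))
  have h1 : ∀ (k : ℕ) (n : ℤ), ∃ d ∈ D, (n : ℝ) / (k + 1) < d ∧ d < (n + 1) / (k + 1) :=
      fun k n => by
    obtain ⟨d, hd, h⟩ := hD.exists_between
      (show (n : ℝ) / (k + 1) < (n + 1) / (k + 1) by gcongr; linarith)
    exact ⟨d, hd, h⟩
  choose d hdD hd1 hd2 using h1
  have hmono : ∀ k, Monotone fun x : ℝ => d k ⌊x * (k + 1)⌋ := by
    intro k x y hxy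
    have h2 : ⌊x * (k + 1)⌋ ≤ ⌊y * (k + 1)⌋ := Int.floor_mono (by gcongr)
    rcases h2.eq_or_lt with h3 | h3
    · simp only [h3, le_refl]
    · refine ((hd2 k _).le.trans ?_).trans (hd1 k _).le
      gcongr
      exact_mod_cast h3
  have hlim : ∀ x : ℝ, Tendsto (fun k : ℕ => d k ⌊x * (k + 1)⌋) atTop (𝓝 x) := by
    intro x
    have hz := tendsto_one_div_add_atTop_nhds_zero_nat (𝕜 := ℝ)
    refine tendsto_of_tendsto_of_tendsto_of_le_of_le
      (g := fun k : ℕ => x - 1 / ((k : ℝ) + 1)) (h := fun k : ℕ => x + 1 / ((k : ℝ) + 1))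
      ?_ ?_ (fun k => ?_) (fun k => ?_)
    · simpa using (tendsto_const_nhds (x := x)).sub hz
    · simpa using (tendsto_const_nhds (x := x)).add hz
    · refine le_trans ?_ (hd1 k _).le
      have := Int.lt_floor_add_one (x * ((k : ℝ) + 1))
      rw [le_div_iff₀ (by positivity), sub_mul, one_div_mul_cancel (by positivity)]
      linarith
    · refine (hd2 k _).le.trans ?_
      have := Int.floor_le (x * ((k : ℝ) + 1))
      rw [div_le_iff₀ (by positivity), add_mul, one_div_mul_cancel (by positivity)]
      linarith
  refine le_of_forall_lt fun c hc => ?_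
  have h2 := eVariationOn.lowerSemicontinuous_aux (p := atTop)
    (F := fun (k : ℕ) (x : ℝ) => h (d k ⌊x * (k + 1)⌋)) (s := Set.univ)
    (fun x _ => (hh.tendsto x).comp (hlim x)) hc
  obtain ⟨k, hk⟩ := h2.exists
  exact hk.trans_le (eVariationOn.comp_le_of_monotoneOn h _ ((hmono k).monotoneOn _)
    fun x _ => hdD k _)

/-- For c ≥ 0 the set {|h| > c} is the disjoint union of {h > c} and {-h > c}, so the indicators
add; for c < 0 it is the whole line. -/
theorem levelVar_abs_le (D : Set ℝ) (h : ℝ → ℝ) (c : ℝ) :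
    levelVar D (fun x => |h x|) c ≤ levelVar D h c + levelVar D (-h) c := by
  rcases lt_or_ge c 0 with hc | hc
  · have : {x | c < |h x|} = Set.univ := Set.eq_univ_of_forall fun x => hc.trans_le (abs_nonneg _)
    rw [levelVar, this, eVariationOn.constant_on]
    · exact zero_le
    · rintro _ ⟨x, -, rfl⟩ _ ⟨y, -, rfl⟩
      simp
  · refine le_trans (le_of_eq ?_) (eVariationOn_add_le _ _ D)
    rw [levelVar]
    congr 1
    ext x
    simp only [Set.indicator, Set.mem_ofPred_eq, Pi.add_apply, Pi.one_apply, Pi.neg_apply, lt_abs]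
    by_cases h1 : c < h x <;> by_cases h2 : c < -h x <;> simp [h1, h2]
    linarith

theorem eVariationOn_abs_le (D : Set ℝ) (h : ℝ → ℝ) :
    eVariationOn (fun x => |h x|) D ≤ eVariationOn h D := by
  refine iSup_le fun p => le_trans (Finset.sum_le_sum fun i _ => ?_)
    (eVariationOn.sum_le p.2.2.1 p.2.2.2)
  rw [edist_dist, edist_dist, Real.dist_eq, Real.dist_eq]
  exact ENNReal.ofReal_le_ofReal (abs_abs_sub_abs_le_abs_sub _ _)

theorem le_on_closure_of_dense {D : Set ℝ} (hD : Dense D) {a b c : ℝ} {h : ℝ → ℝ}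
    (hle : ∀ y ∈ D, y ∈ Set.Ioo a b → h y ≤ c) {x : ℝ} (hx : x ∈ Set.Ioo a b)
    (hc : ContinuousAt h x) : h x ≤ c := by
  by_contra! hlt
  obtain ⟨y, hy, h1, h2⟩ := hD.inter_nhds_nonempty
    (inter_mem (hc.eventually_const_lt hlt) (isOpen_Ioo.mem_nhds hx))
  exact absurd (hle y hy h2) (not_le.2 h1)

namespace BV

theorem countable_not_continuousAt (f : BV) : {x | ¬ ContinuousAt f x}.Countable := by
  obtain ⟨p, q, hp, hq, h⟩ :=
    f.boundedVariationOn.locallyBoundedVariationOn.exists_monotoneOn_sub_monotoneOn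
  rw [monotoneOn_univ] at hp hq
  refine (hp.countable_not_continuousAt.union hq.countable_not_continuousAt).mono fun x hx => ?_
  by_contra hn
  simp only [Set.mem_union, Set.mem_ofPred_eq, not_or, not_not] at hn
  exact hx (h ▸ hn.1.sub hn.2)

theorem ae_continuousAt (f : BV) : ∀ᵐ x, ContinuousAt f x := by
  have := f.countable_not_continuousAt.ae_notMem volume
  simpa using this

theorem exists_countable_dense_continuousAt {ι : Type*} [Countable ι] (F : ι → BV) :
    ∃ D : Set ℝ, D.Countable ∧ Dense D ∧ ∀ i, ∀ x ∈ D, ContinuousAt (F i) x := by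
  have h1 : (⋃ i, {x | ¬ ContinuousAt (F i) x}).Countable :=
    Set.countable_iUnion fun i => (F i).countable_not_continuousAt
  obtain ⟨D, hD, hDc, hDd⟩ := (h1.dense_compl ℝ).exists_countable_dense_subset
  refine ⟨D, hDc, hDd, fun i x hx => ?_⟩
  by_contra hn
  exact hD hx (Set.mem_iUnion.2 ⟨i, hn⟩)

/-- An interval whose average exceeds c lies inside the component of x. If |f| ≤ c at all its points
in D, then also at its continuity points, hence almost everywhere, contradicting the average. -/
theorem exists_mem_lt_abs (f : BV) {D : Set ℝ} (hD : Dense D) {c x : ℝ}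
    (hx : c < uncenteredMaximal f x) :
    ∃ y ∈ {x | c < uncenteredMaximal f x}.ordConnectedComponent x, y ∈ D ∧ c < |f y| := by
  obtain ⟨a, b, ha, hb, h⟩ := f.exists_lt_integral hx
  have hsub : Set.Ioo a b ⊆ {x | c < uncenteredMaximal f x} := fun z hz =>
    lt_of_mul_lt_mul_left (h.trans_le (f.integral_le hz.1.le hz.2.le)) (by linarith)
  by_contra! hn
  have h1 : ∀ y ∈ D, y ∈ Set.Ioo a b → |f y| ≤ c := fun y hyD hy =>
    hn y (Set.mem_ordConnectedComponent.2
      ((Set.ordConnected_Ioo.uIcc_subset ⟨ha, hb⟩ hy).trans hsub)) hyD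
  refine absurd (integral_le_mul (ha.trans hb).le ?_) h.not_ge
  filter_upwards [f.ae_continuousAt] with t ht htab
  exact le_on_closure_of_dense (h := fun x => |f x|) hD h1 htab ht.abs

/-- Points of {M̃f > c} are sent to a point of D in their component with |f| > c; all others stay
fixed, and there |f| ≤ c because M̃f dominates |f| at continuity points. -/
theorem levelVar_uncenteredMaximal_le (f : BV) {D : Set ℝ} (hD : Dense D)
    (hDc : ∀ x ∈ D, ContinuousAt f x) (c : ℝ) :
    levelVar D (uncenteredMaximal f) c ≤ levelVar D (fun x => |f x|) c := by
  classical
  let A := {x | c < uncenteredMaximal f x}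
  let T := {x | x ∈ D ∧ c < |f x|}
  have hne : ∀ x ∈ A, (A.ordConnectedComponent x ∩ T).Nonempty := fun x hx =>
    f.exists_mem_lt_abs hD hx
  refine eVariationOn_indicator_le_of_monotoneOn
    (φ := fun x => if x ∈ A then componentPoint A T x else x) ?_ ?_ ?_
  · intro x _ y _ hxy
    by_cases hx : x ∈ A <;> by_cases hy : y ∈ A <;> simp only [hx, hy, if_true, if_false]
    · exact componentPoint_mono hxy (hne x hx) (hne y hy)
    · exact (lt_of_mem_ordConnectedComponent (componentPoint_mem (hne x hx)).1 hy hxy).le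
    · exact (gt_of_mem_ordConnectedComponent (componentPoint_mem (hne y hy)).1 hx hxy).le
    · exact hxy
  · intro x hxD
    by_cases hx : x ∈ A <;> simp only [hx, if_true, if_false]
    · exact (componentPoint_mem (hne x hx)).2.1
    · exact hxD
  · intro x hxD
    change x ∈ A ↔ _
    by_cases hx : x ∈ A <;> simp only [hx, if_true, if_false, true_iff, false_iff]
    · exact (componentPoint_mem (hne x hx)).2.2
    · exact fun h => hx ((show c < |f x| from h).trans_le (abs_le_uncenteredMaximal (hDc x hxD)))

theorem eVariationOn_uncenteredMaximal_le (f : BV) :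
    eVariationOn (uncenteredMaximal f) Set.univ ≤ eVariationOn f Set.univ := by
  obtain ⟨D, hDc, hDd, hc⟩ := exists_countable_dense_continuousAt fun _ : Unit => f
  rw [eVariationOn_eq_of_dense hDd f.continuous_uncenteredMaximal, ← lintegral_levelVar hDc]
  calc ∫⁻ c, levelVar D (uncenteredMaximal f) c ≤ ∫⁻ c, levelVar D (fun x => |f x|) c :=
        lintegral_mono fun c => f.levelVar_uncenteredMaximal_le hDd (hc ()) c
    _ = eVariationOn (fun x => |f x|) D := lintegral_levelVar hDc _
    _ ≤ eVariationOn f D := eVariationOn_abs_le D f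
    _ ≤ _ := eVariationOn.mono f (Set.subset_univ D)

theorem boundedVariationOn_uncenteredMaximal (f : BV) :
    BoundedVariationOn (uncenteredMaximal f) Set.univ :=
  ne_top_of_le_ne_top f.boundedVariationOn f.eVariationOn_uncenteredMaximal_le

end BV

/-! ### Runs of superlevel sets and finite test sets -/

theorem edist_indicator_le_one (A : Set ℝ) (x y : ℝ) :
    edist (A.indicator (1 : ℝ → ℝ) x) (A.indicator (1 : ℝ → ℝ) y) ≤ 1 := by
  by_cases hx : x ∈ A <;> by_cases hy : y ∈ A <;> simp [hx, hy]

theorem edist_indicator_of_notMem {A : Set ℝ} {x y : ℝ} (hx : x ∈ A) (hy : y ∉ A) :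
    edist (A.indicator (1 : ℝ → ℝ) x) (A.indicator (1 : ℝ → ℝ) y) = 1 := by
  simp [hx, hy]

/-- If a finite set captures the variation of an indicator function on `D`, then it meets every
run of the underlying set. -/
theorem exists_mem_run {A D : Set ℝ} {P : Finset ℝ} (hP : P.Nonempty) (hPD : (P : Set ℝ) ⊆ D)
    (hv : eVariationOn (A.indicator (1 : ℝ → ℝ)) D < eVariationOn (A.indicator (1 : ℝ → ℝ)) P + 1)
    {y : ℝ} (hyD : y ∈ D) (hyA : y ∈ A) :
    ∃ p ∈ P, ∀ z ∈ D, z ∈ Set.uIcc y p → z ∈ A := by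
  classical
  by_contra! hn
  set χ := A.indicator (1 : ℝ → ℝ) with hχ
  have hne : ∀ p ∈ P, p ≠ y := by
    rintro p hp rfl
    obtain ⟨z, -, hz, hzA⟩ := hn p hp
    rw [Set.uIcc_self, Set.mem_singleton_iff] at hz
    exact hzA (hz ▸ hyA)
  set Pl := P.filter (· < y) with hPl
  set Pr := P.filter (y < ·) with hPr
  have hPu : (P : Set ℝ) = (Pl : Set ℝ) ∪ (Pr : Set ℝ) := by
    ext p
    simp only [hPl, hPr, Finset.coe_filter, Set.mem_union, Set.mem_ofPred_eq, Finset.mem_coe]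
    constructor
    · intro hp
      rcases lt_or_gt_of_ne (hne p hp) with h | h
      exacts [Or.inl ⟨hp, h⟩, Or.inr ⟨hp, h⟩]
    · rintro (h | h) <;> exact h.1
  have hl : ∀ h : Pl.Nonempty, ∃ z ∈ D, z ∉ A ∧ Pl.max' h ≤ z ∧ z ≤ y := by
    intro h
    have hm := Finset.mem_filter.1 (Pl.max'_mem h)
    obtain ⟨z, hzD, hz, hzA⟩ := hn _ hm.1
    rw [Set.uIcc_of_ge hm.2.le] at hz
    exact ⟨z, hzD, hzA, hz.1, hz.2⟩
  have hr : ∀ h : Pr.Nonempty, ∃ z ∈ D, z ∉ A ∧ y ≤ z ∧ z ≤ Pr.min' h := by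
    intro h
    have hm := Finset.mem_filter.1 (Pr.min'_mem h)
    obtain ⟨z, hzD, hz, hzA⟩ := hn _ hm.1
    rw [Set.uIcc_of_le hm.2.le] at hz
    exact ⟨z, hzD, hzA, hz.1, hz.2⟩
  have hPlD : (Pl : Set ℝ) ⊆ D := fun p hp => hPD (Finset.mem_filter.1 hp).1
  have hPrD : (Pr : Set ℝ) ⊆ D := fun p hp => hPD (Finset.mem_filter.1 hp).1
  have hleft : ∀ h : Pl.Nonempty, ∃ z ∈ D, z ≤ y ∧
      eVariationOn χ Pl + 1 ≤ eVariationOn χ ((Pl : Set ℝ) ∪ {z, y}) := by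
    intro h
    obtain ⟨z, hzD, hzA, hz, hzy⟩ := hl h
    refine ⟨z, hzD, hzy, ?_⟩
    have h1 := eVariationOn.add_le_union χ (s := (Pl : Set ℝ)) (t := {z, y}) (by
      rintro p hp q (rfl | rfl)
      · exact (Pl.le_max' p hp).trans hz
      · exact (Finset.mem_filter.1 hp).2.le)
    rwa [eVariationOn.pair, edist_comm, edist_indicator_of_notMem hyA hzA] at h1
  have hright : ∀ h : Pr.Nonempty, ∃ z ∈ D, y ≤ z ∧
      1 + eVariationOn χ Pr ≤ eVariationOn χ ({y, z} ∪ (Pr : Set ℝ)) := by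
    intro h
    obtain ⟨z, hzD, hzA, hz, hzy⟩ := hr h
    refine ⟨z, hzD, hz, ?_⟩
    have h1 := eVariationOn.add_le_union χ (s := {y, z}) (t := (Pr : Set ℝ)) (by
      rintro q (rfl | rfl) p hp
      · exact (Finset.mem_filter.1 hp).2.le
      · exact hzy.trans (Pr.min'_le p hp))
    rwa [eVariationOn.pair, edist_indicator_of_notMem hyA hzA] at h1
  -- Adjoining y and gap points gains one unit of variation on each side of y where P has points. If
  -- both sides have points, at most one unit is lost by cutting P at y. In every case D has at
  -- least one unit more than P.
  refine absurd hv (not_lt.2 ?_)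
  rcases Pl.eq_empty_or_nonempty with h1 | h1 <;> rcases Pr.eq_empty_or_nonempty with h2 | h2
  · obtain ⟨p, hp⟩ := hP
    have : p ∈ (P : Set ℝ) := hp
    rw [hPu, h1, h2] at this
    simp at this
  · rw [hPu, h1, Finset.coe_empty, Set.empty_union]
    obtain ⟨z, hzD, hz, h⟩ := hright h2
    rw [add_comm]
    refine h.trans (eVariationOn.mono χ ?_)
    rintro x ((rfl | rfl) | hx)
    exacts [hyD, hzD, hPrD hx]
  · rw [hPu, h2, Finset.coe_empty, Set.union_empty]
    obtain ⟨z, hzD, hz, h⟩ := hleft h1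
    refine h.trans (eVariationOn.mono χ ?_)
    rintro x (hx | (rfl | rfl))
    exacts [hPlD hx, hzD, hyD]
  · obtain ⟨z, hzD, hz, h⟩ := hleft h1
    obtain ⟨z', hzD', hz', h'⟩ := hright h2
    have h3 := eVariationOn.add_le_union χ (s := (Pl : Set ℝ) ∪ {z, y})
      (t := {y, z'} ∪ (Pr : Set ℝ)) (by
        have ha : ∀ p ∈ (Pl : Set ℝ) ∪ {z, y}, p ≤ y := by
          rintro p (hp | (rfl | rfl))
          exacts [(Finset.mem_filter.1 hp).2.le, hz, le_rfl]
        have hb : ∀ p ∈ {y, z'} ∪ (Pr : Set ℝ), y ≤ p := by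
          rintro p ((rfl | rfl) | hp)
          exacts [le_rfl, hz', (Finset.mem_filter.1 hp).2.le]
        exact fun p hp q hq => (ha p hp).trans (hb q hq))
    have h4 := eVariationOn.mono χ (s := D)
      (t := ((Pl : Set ℝ) ∪ {z, y}) ∪ ({y, z'} ∪ (Pr : Set ℝ))) (by
        rintro x ((hx | (rfl | rfl)) | ((rfl | rfl) | hx))
        exacts [hPlD hx, hzD, hyD, hyD, hzD', hPrD hx])
    rw [hPu, eVariationOn.union' χ (Pl.isGreatest_max' h1) (Pr.isLeast_min' h2)
      ((Finset.mem_filter.1 (Pl.max'_mem h1)).2.trans (Finset.mem_filter.1 (Pr.min'_mem h2)).2).le]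
    calc _ ≤ eVariationOn χ Pl + 1 + eVariationOn χ Pr + 1 := by
          gcongr
          exact edist_indicator_le_one A _ _
      _ = (eVariationOn χ Pl + 1) + (1 + eVariationOn χ Pr) := by ring
      _ ≤ _ := (add_le_add h h').trans (h3.trans h4)

/-- Comparison of indicator variations when every run of `A` meets a finite set `T ⊆ B`, and any
two points of `T` (or ends of the line) not separated by a gap of `B` are joined inside `A`. -/
theorem eVariationOn_indicator_le_of_finite {A B D T : Set ℝ} (hT : T.Finite) (hTD : T ⊆ D)
    (hTA : T ⊆ A) (hTB : T ⊆ B)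
    (hA : ∀ x ∈ D, x ∈ A → (A.ordConnectedComponent x ∩ T).Nonempty)
    (hgap : ∀ a ∈ insert ⊥ (insert ⊤ (Real.toEReal '' T)),
      ∀ b ∈ insert ⊥ (insert ⊤ (Real.toEReal '' T)),
      (∃ q ∈ D, a < (q : EReal) ∧ (q : EReal) < b ∧ q ∉ B) ∨
        ∀ x : ℝ, a < (x : EReal) → (x : EReal) < b → x ∈ A) :
    eVariationOn (A.indicator (1 : ℝ → ℝ)) D ≤ eVariationOn (B.indicator (1 : ℝ → ℝ)) D := by
  classical
  set E : Set EReal := insert ⊥ (insert ⊤ (Real.toEReal '' T)) with hE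
  have hEf : E.Finite := ((hT.image _).insert _).insert _
  -- The chosen gap point depends only on the pair of neighbouring points of E, so points outside A
  -- with the same neighbours share an image.
  let q : EReal → EReal → ℝ := fun a b =>
    Classical.epsilon fun q => q ∈ D ∧ a < (q : EReal) ∧ (q : EReal) < b ∧ q ∉ B
  let lo : ℝ → EReal := fun x => sSup {p ∈ E | p < x}
  let hi : ℝ → EReal := fun x => sInf {p ∈ E | (x : EReal) < p}
  have hlo : ∀ x : ℝ, lo x ∈ {p ∈ E | p < (x : EReal)} := fun x =>
    Set.Nonempty.csSup_mem ⟨⊥, by simp [hE], EReal.bot_lt_coe x⟩ (hEf.subset fun p hp => hp.1)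
  have hhi : ∀ x : ℝ, hi x ∈ {p ∈ E | (x : EReal) < p} := fun x =>
    Set.Nonempty.csInf_mem ⟨⊤, by simp [hE], EReal.coe_lt_top x⟩ (hEf.subset fun p hp => hp.1)
  have hlo' : ∀ x p, p ∈ E → p < ((x : ℝ) : EReal) → p ≤ lo x := fun x p h1 h2 => le_sSup ⟨h1, h2⟩
  have hhi' : ∀ x p, p ∈ E → ((x : ℝ) : EReal) < p → hi x ≤ p := fun x p h1 h2 => sInf_le ⟨h1, h2⟩
  have hq : ∀ x ∉ A, q (lo x) (hi x) ∈ D ∧ lo x < (q (lo x) (hi x) : EReal) ∧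
      (q (lo x) (hi x) : EReal) < hi x ∧ q (lo x) (hi x) ∉ B := by
    intro x hx
    exact Classical.epsilon_spec ((hgap _ (hlo x).1 _ (hhi x).1).resolve_right fun h =>
      hx (h x (hlo x).2 (hhi x).2))
  have hmem : ∀ p ∈ T, (p : EReal) ∈ E := fun p hp => by
    simp only [hE, Set.mem_insert_iff, Set.mem_image]
    exact Or.inr (Or.inr ⟨p, hp, rfl⟩)
  -- Points of A go to a point of T in their component; points outside A go to a gap of B between
  -- their two neighbours in E. The points of E keep these images in order.
  refine eVariationOn_indicator_le_of_monotoneOn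
    (φ := fun x => if x ∈ A then componentPoint A T x else q (lo x) (hi x)) ?_ ?_ ?_
  · intro x hxD y hyD hxy
    by_cases hx : x ∈ A <;> by_cases hy : y ∈ A <;> simp only [hx, hy, if_true, if_false]
    · exact componentPoint_mono hxy (hA x hxD hx) (hA y hyD hy)
    · have h1 := componentPoint_mem (hA x hxD hx)
      have h2 := lt_of_mem_ordConnectedComponent h1.1 hy hxy
      have h3 := (hlo' y _ (hmem _ h1.2) (by exact_mod_cast h2)).trans_lt (hq y hy).2.1
      exact_mod_cast h3.le
    · have h1 := componentPoint_mem (hA y hyD hy)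
      have h2 := gt_of_mem_ordConnectedComponent h1.1 hx hxy
      have h3 := (hq x hx).2.2.1.trans_le (hhi' x _ (hmem _ h1.2) (by exact_mod_cast h2))
      exact_mod_cast h3.le
    · by_cases h : ∃ p ∈ E, (x : EReal) ≤ p ∧ p ≤ (y : EReal)
      · obtain ⟨p, hp, hxp, hpy⟩ := h
        have hnot : ∀ z : ℝ, z ∉ A → p ≠ (z : EReal) := by
          rintro z hz rfl
          simp only [hE, Set.mem_insert_iff, EReal.coe_ne_bot, EReal.coe_ne_top, false_or] at hp
          obtain ⟨t, ht, htz⟩ := hp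
          exact hz (EReal.coe_injective htz ▸ hTA ht)
        have h1 := (hq x hx).2.2.1.trans_le (hhi' x p hp (lt_of_le_of_ne hxp (hnot x hx).symm))
        have h2 := (hlo' y p hp (lt_of_le_of_ne hpy (hnot y hy))).trans_lt (hq y hy).2.1
        exact_mod_cast (h1.trans h2).le
      · push Not at h
        have hxy' : (x : EReal) ≤ y := by exact_mod_cast hxy
        have h1 : lo x = lo y := by
          refine congrArg sSup (Set.ext fun p => ?_)
          refine and_congr_right fun hp => ⟨fun h' => h'.trans_le hxy', fun h' => ?_⟩
          by_contra! h2
          exact absurd (h p hp h2) (not_lt.2 h'.le)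
        have h2 : hi x = hi y := by
          refine congrArg sInf (Set.ext fun p => ?_)
          refine and_congr_right fun hp => ⟨fun h' => h p hp h'.le, fun h' => hxy'.trans_lt h'⟩
        rw [h1, h2]
  · intro x hxD
    by_cases hx : x ∈ A <;> simp only [hx, if_true, if_false]
    · exact hTD (componentPoint_mem (hA x hxD hx)).2
    · exact (hq x hx).1
  · intro x hxD
    by_cases hx : x ∈ A <;> simp only [hx, if_true, if_false, true_iff, false_iff]
    · exact hTB (componentPoint_mem (hA x hxD hx)).2
    · exact (hq x hx).2.2.2

/-! ### Generic levels -/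

/-- The points of `D` together with the two ends of the line. -/
def extendedPoints (D : Set ℝ) : Set EReal := insert ⊥ (insert ⊤ (Real.toEReal '' D))

/-- The infima of `u` over the intervals with endpoints in `D ∪ {±∞}`. -/
def infLevels (D : Set ℝ) (u : ℝ → ℝ) : Set ℝ :=
  (fun p : EReal × EReal => sInf (u '' {x : ℝ | p.1 < (x : EReal) ∧ (x : EReal) < p.2})) ''
    (extendedPoints D ×ˢ extendedPoints D)

theorem countable_infLevels {D : Set ℝ} (hD : D.Countable) (u : ℝ → ℝ) :
    (infLevels D u).Countable := by
  have : (extendedPoints D).Countable := ((hD.image _).insert _).insert _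
  exact (this.prod this).image _

/-- The infimum over the interval is not c, so it lies strictly on one side. The positive margin in
the second case is what survives a uniformly small perturbation. -/
theorem exists_lt_or_forall_add_le {D : Set ℝ} (hD : Dense D) {u : ℝ → ℝ} (hu : Continuous u)
    (h0 : ∀ x, 0 ≤ u x) {a b : EReal} (ha : a ∈ extendedPoints D) (hb : b ∈ extendedPoints D)
    {c : ℝ} (hc : c ∉ infLevels D u) :
    (∃ q ∈ D, a < (q : EReal) ∧ (q : EReal) < b ∧ u q < c) ∨
      ∃ δ > 0, ∀ x : ℝ, a < (x : EReal) → (x : EReal) < b → c + δ ≤ u x := by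
  set I := {x : ℝ | a < (x : EReal) ∧ (x : EReal) < b} with hI
  have hIo : IsOpen I := (isOpen_lt continuous_const continuous_coe_real_ereal).inter
    (isOpen_lt continuous_coe_real_ereal continuous_const)
  have hbdd : BddBelow (u '' I) := ⟨0, by rintro _ ⟨x, -, rfl⟩; exact h0 x⟩
  have hne : c ≠ sInf (u '' I) := fun h => hc ⟨(a, b), ⟨ha, hb⟩, h.symm⟩
  rcases lt_or_gt_of_ne hne with h | h
  · refine Or.inr ⟨sInf (u '' I) - c, sub_pos.2 h, fun x h1 h2 => ?_⟩
    rw [add_sub_cancel]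
    exact csInf_le hbdd ⟨x, ⟨h1, h2⟩, rfl⟩
  · rcases I.eq_empty_or_nonempty with he | hIne
    · exact Or.inr ⟨1, one_pos, fun x h1 h2 =>
        absurd (he ▸ (⟨h1, h2⟩ : x ∈ I)) (Set.notMem_empty x)⟩
    obtain ⟨_, ⟨x, hx, rfl⟩, hxc⟩ := exists_lt_of_csInf_lt (hIne.image u) h
    obtain ⟨q, hqD, hq, hqI⟩ := hD.inter_nhds_nonempty
      (inter_mem (hu.continuousAt.eventually_lt_const hxc) (hIo.mem_nhds hx))
    exact Or.inl ⟨q, hqD, hqI.1, hqI.2, hq⟩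

theorem exists_finset_levelVar_lt {D : Set ℝ} (hD : D.Countable) (hne : D.Nonempty) {h : ℝ → ℝ}
    {c : ℝ} (hfin : levelVar D h c ≠ ∞) {ε : ℝ≥0∞} (hε : ε ≠ 0) :
    ∃ P : Finset ℝ, P.Nonempty ∧ (P : Set ℝ) ⊆ D ∧ levelVar D h c < levelVar P h c + ε := by
  classical
  obtain ⟨d, hd⟩ := hne
  suffices ∃ P : Finset ℝ, (P : Set ℝ) ⊆ D ∧ levelVar D h c < levelVar P h c + ε by
    obtain ⟨P, hP, hlt⟩ := this
    refine ⟨insert d P, Finset.insert_nonempty _ _, ?_, hlt.trans_le ?_⟩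
    · rw [Finset.coe_insert]
      exact Set.insert_subset hd hP
    · gcongr
      exact eVariationOn.mono _ (by simp)
  rcases eq_or_ne (levelVar D h c) 0 with h0 | h0
  · exact ⟨∅, by simp, by rw [h0]; exact (pos_iff_ne_zero.2 hε).trans_le le_add_self⟩
  obtain ⟨S, hS, hSD⟩ := exists_monotone_finset_iUnion hD
  have hlt := ENNReal.sub_lt_self hfin h0 hε
  nth_rewrite 2 [levelVar] at hlt
  rw [← hSD, eVariationOn_iUnion_of_monotone _ hS] at hlt
  obtain ⟨n, hn⟩ := lt_iSup_iff.1 hlt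
  refine ⟨S n, by rw [← hSD]; exact Set.subset_iUnion (fun n => (S n : Set ℝ)) n, ?_⟩
  rw [hSD] at hn
  have := ENNReal.lt_add_right (b := ε) hfin hε
  by_contra! hle
  exact absurd hn (not_lt.2 (ENNReal.le_sub_of_add_le_right
    (ne_top_of_le_ne_top hfin (le_add_self.trans hle)) hle))

/-- P captures the variation of {h > c} up to 1/2, and for large j the excess of {H j > c} is below
1/2. The indicators agree on P, so P captures the variation of {H j > c} up to less than 1, as
`exists_mem_run` requires. -/
theorem exists_finset_eventually_run {D : Set ℝ} (hD : D.Countable) (hne : D.Nonempty)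
    {H : ℕ → ℝ → ℝ} {h : ℝ → ℝ} (hconv : ∀ x ∈ D, Tendsto (fun j => H j x) atTop (𝓝 (h x)))
    {c : ℝ} (hc : c ∉ h '' D) (hfin : levelVar D h c ≠ ∞)
    (hlim : Tendsto (fun j => levelVar D (H j) c - levelVar D h c) atTop (𝓝 0)) :
    ∃ P : Finset ℝ, (P : Set ℝ) ⊆ D ∧ ∀ᶠ j in atTop, (∀ p ∈ P, c < H j p ↔ c < h p) ∧
      ∀ y ∈ D, c < H j y → ∃ p ∈ P, ∀ z ∈ D, z ∈ Set.uIcc y p → c < H j z := by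
  obtain ⟨P, hPne, hPD, hP⟩ := exists_finset_levelVar_lt hD hne hfin
    (ENNReal.inv_ne_zero.2 ENNReal.ofNat_ne_top : (2 : ℝ≥0∞)⁻¹ ≠ 0)
  refine ⟨P, hPD, ?_⟩
  have h1 : ∀ᶠ j in atTop, ∀ p ∈ P, c < H j p ↔ c < h p := by
    rw [Filter.eventually_all_finset]
    intro p hp
    rcases lt_or_gt_of_ne (fun hcp : c = h p => hc ⟨p, hPD hp, hcp.symm⟩) with hlt | hlt
    · filter_upwards [(hconv p (hPD hp)).eventually_const_lt hlt] with j hj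
      simp [hlt, hj]
    · filter_upwards [(hconv p (hPD hp)).eventually_lt_const hlt] with j hj
      simp [hlt.not_gt, hj.not_gt]
  filter_upwards [h1, hlim.eventually_lt_const
    (ENNReal.inv_pos.2 ENNReal.ofNat_ne_top : (0 : ℝ≥0∞) < 2⁻¹)] with j hj hj2
  refine ⟨hj, fun y hyD hy => exists_mem_run (A := {x | c < H j x}) hPne hPD ?_ hyD hy⟩
  have h2 : levelVar P (H j) c = levelVar P h c := by
    refine eVariationOn.congr fun p hp => ?_
    simp only [Set.indicator, Set.mem_ofPred_eq, Pi.one_apply]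
    by_cases hlt : c < h p
    · simp [hlt, (hj p hp).2 hlt]
    · have : ¬ c < H j p := fun h' => hlt ((hj p hp).1 h')
      simp [hlt, this]
  change levelVar D (H j) c < levelVar P (H j) c + 1
  rw [h2, ← ENNReal.inv_two_add_inv_two, ← add_assoc]
  calc levelVar D (H j) c ≤ levelVar D h c + (levelVar D (H j) c - levelVar D h c) :=
        le_add_tsub
    _ < levelVar P h c + 2⁻¹ + 2⁻¹ := ENNReal.add_lt_add hP hj2

/-! ### Upper semicontinuity of the variation -/

namespace BV

/-- A run is only known on D, where M̃g ≥ |g| > c. Since c is not the infimum of M̃g between the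
endpoints, M̃g cannot touch c between points of D, so the whole run lies in one component of {M̃g >
c}. -/
theorem uIcc_subset_superlevel (g : BV) {D : Set ℝ} (hD : Dense D)
    (hDc : ∀ x ∈ D, ContinuousAt g x) {c : ℝ} (hc : c ∉ infLevels D (uncenteredMaximal g))
    {y p : ℝ} (hy : y ∈ D) (hp : p ∈ D) (h : ∀ z ∈ D, z ∈ Set.uIcc y p → c < |g z|) :
    Set.uIcc y p ⊆ {x | c < uncenteredMaximal g x} := by
  wlog hyp : y ≤ p generalizing y p
  · rw [Set.uIcc_comm] at h ⊢
    exact this hp hy h (not_le.1 hyp).le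
  rw [Set.uIcc_of_le hyp] at h ⊢
  have hU : ∀ z ∈ D, z ∈ Set.Icc y p → c < uncenteredMaximal g z := fun z hz hz' =>
    (h z hz hz').trans_le (abs_le_uncenteredMaximal (hDc z hz))
  have hmem : ∀ z ∈ D, (z : EReal) ∈ extendedPoints D := fun z hz => by
    simp only [extendedPoints, Set.mem_insert_iff, Set.mem_image]
    exact Or.inr (Or.inr ⟨z, hz, rfl⟩)
  rcases exists_lt_or_forall_add_le hD g.continuous_uncenteredMaximal g.uncenteredMaximal_nonneg
    (hmem y hy) (hmem p hp) hc with ⟨q, hqD, h1, h2, hq⟩ | ⟨δ, hδ, hδ'⟩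
  · exact absurd hq (hU q hqD ⟨by exact_mod_cast h1.le, by exact_mod_cast h2.le⟩).not_gt
  · intro x hx
    rcases hx.1.eq_or_lt with rfl | h1
    · exact hU _ hy hx
    rcases hx.2.eq_or_lt with rfl | h2
    · exact hU _ hp hx
    have := hδ' x (by exact_mod_cast h1) (by exact_mod_cast h2)
    change c < _
    linarith

/-- For generic levels, the variation of the superlevel sets of the maximal function does not
increase in the limit. -/
theorem eventually_levelVar_uncenteredMaximal_le {F : ℕ → BV} {f : BV}
    (hF : Tendsto (fun j => ‖F j - f‖) atTop (𝓝 0)) {D : Set ℝ} (hD : D.Countable) (hDd : Dense D)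
    (hDF : ∀ j, ∀ x ∈ D, ContinuousAt (F j) x) (hDf : ∀ x ∈ D, ContinuousAt f x) {c : ℝ}
    (hc1 : c ∉ f '' D) (hc2 : c ∉ (-f.toFun) '' D) (hc3 : c ∉ infLevels D (uncenteredMaximal f))
    (hc4 : ∀ j, c ∉ infLevels D (uncenteredMaximal (F j)))
    (hfin1 : levelVar D f c ≠ ∞) (hfin2 : levelVar D (-f.toFun) c ≠ ∞)
    (hlim1 : Tendsto (fun j => levelVar D (F j) c - levelVar D f c) atTop (𝓝 0))
    (hlim2 : Tendsto (fun j => levelVar D (-(F j).toFun) c - levelVar D (-f.toFun) c)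
      atTop (𝓝 0)) :
    ∀ᶠ j in atTop,
      levelVar D (uncenteredMaximal (F j)) c ≤ levelVar D (uncenteredMaximal f) c := by
  have hconv : ∀ x, Tendsto (fun j => F j x) atTop (𝓝 (f x)) := fun x =>
    tendsto_iff_dist_tendsto_zero.2
      (squeeze_zero (fun _ => dist_nonneg) (fun j => abs_sub_le_norm (F j) f x) hF)
  obtain ⟨P, hPD, hP⟩ := exists_finset_eventually_run hD hDd.nonempty (fun x _ => hconv x) hc1
    hfin1 hlim1
  obtain ⟨Q, hQD, hQ⟩ := exists_finset_eventually_run (H := fun j => -(F j).toFun) hD hDd.nonempty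
    (fun x _ => (hconv x).neg) hc2 hfin2 hlim2
  set T : Set ℝ := {p | (p ∈ P ∨ p ∈ Q) ∧ c < |f p|} with hT
  have hTf : T.Finite := (P.finite_toSet.union Q.finite_toSet).subset fun p hp => hp.1
  have hTD : T ⊆ D := fun p hp => hp.1.elim (fun h => hPD h) fun h => hQD h
  have hE : insert ⊥ (insert ⊤ (Real.toEReal '' T)) ⊆ extendedPoints D :=
    Set.insert_subset_insert (Set.insert_subset_insert (Set.image_mono hTD))
  have hEf : (insert ⊥ (insert ⊤ (Real.toEReal '' T)) : Set EReal).Finite :=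
    ((hTf.image _).insert _).insert _
  -- Either M̃f dips below c at a point of D in the interval, or it exceeds c there by a uniform δ;
  -- in the latter case uniform convergence keeps the maximal function of F j above c for large j.
  have hgap : ∀ a ∈ insert ⊥ (insert ⊤ (Real.toEReal '' T)),
      ∀ᶠ j in atTop, ∀ b ∈ insert ⊥ (insert ⊤ (Real.toEReal '' T)),
      (∃ q ∈ D, a < (q : EReal) ∧ (q : EReal) < b ∧ q ∉ {x | c < uncenteredMaximal f x}) ∨
        ∀ x : ℝ, a < (x : EReal) → (x : EReal) < b → x ∈ {x | c < uncenteredMaximal (F j) x} := by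
    intro a ha
    rw [Filter.eventually_all_finite hEf]
    intro b hb
    rcases exists_lt_or_forall_add_le hDd f.continuous_uncenteredMaximal
      f.uncenteredMaximal_nonneg (hE ha) (hE hb) hc3 with ⟨q, hqD, h1, h2, hq⟩ | ⟨δ, hδ, h⟩
    · exact Eventually.of_forall fun j => Or.inl ⟨q, hqD, h1, h2, not_lt.2 hq.le⟩
    · filter_upwards [hF.eventually_lt_const hδ] with j hj
      refine Or.inr fun x h1 h2 => ?_
      have h3 := h x h1 h2
      have h4 := abs_uncenteredMaximal_sub_le (F j) f (abs_sub_le_norm (F j) f) x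
      have h5 := neg_abs_le (uncenteredMaximal (F j) x - uncenteredMaximal f x)
      change c < _
      linarith
  have hTA : ∀ᶠ j in atTop, ∀ p ∈ T, c < |F j p| := by
    rw [Filter.eventually_all_finite hTf]
    exact fun p hp => (hconv p).abs.eventually_const_lt hp.2
  filter_upwards [hP, hQ, (Filter.eventually_all_finite hEf).2 hgap, hTA]
    with j ⟨hP1, hP2⟩ ⟨hQ1, hQ2⟩ hj hjT
  refine eVariationOn_indicator_le_of_finite hTf hTD
    (fun p hp => (hjT p hp).trans_le (abs_le_uncenteredMaximal (hDF j p (hTD hp))))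
    (fun p hp => hp.2.trans_le (abs_le_uncenteredMaximal (hDf p (hTD hp)))) (fun x hxD hx => ?_) hj
  obtain ⟨y, hyx, hyD, hy⟩ := (F j).exists_mem_lt_abs hDd hx
  rcases lt_abs.1 hy with hy | hy
  · obtain ⟨p, hp, hrun⟩ := hP2 y hyD hy
    have hsub := (F j).uIcc_subset_superlevel hDd (hDF j) (hc4 j) hyD (hPD hp)
      fun z hz hz' => (hrun z hz hz').trans_le (le_abs_self _)
    exact ⟨p, Set.mem_ordConnectedComponent_trans hyx hsub, Or.inl hp,
      ((hP1 p hp).1 (hrun p (hPD hp) Set.right_mem_uIcc)).trans_le (le_abs_self _)⟩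
  · obtain ⟨p, hp, hrun⟩ := hQ2 y hyD hy
    have hsub := (F j).uIcc_subset_superlevel hDd (hDF j) (hc4 j) hyD (hQD hp)
      fun z hz hz' => (hrun z hz hz').trans_le (neg_le_abs _)
    exact ⟨p, Set.mem_ordConnectedComponent_trans hyx hsub, Or.inr hp,
      ((hQ1 p hp).1 (hrun p (hQD hp) Set.right_mem_uIcc)).trans_le (neg_le_abs _)⟩

end BV

theorem eVariationOn_le_add_of_sub (g h : ℝ → ℝ) (D : Set ℝ) :
    eVariationOn g D ≤ eVariationOn h D + eVariationOn (g - h) D := by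
  simpa using eVariationOn_add_le h (g - h) D

theorem tendsto_eVariationOn_of_sub {D : Set ℝ} {F : ℕ → ℝ → ℝ} {f : ℝ → ℝ}
    (h : Tendsto (fun j => eVariationOn (F j - f) D) atTop (𝓝 0)) :
    Tendsto (fun j => eVariationOn (F j) D) atTop (𝓝 (eVariationOn f D)) := by
  have h1 : Tendsto (fun j => eVariationOn f D + eVariationOn (F j - f) D) atTop
      (𝓝 (eVariationOn f D)) := by simpa using h.const_add (eVariationOn f D)
  have h2 : Tendsto (fun j => eVariationOn f D - eVariationOn (F j - f) D) atTop
      (𝓝 (eVariationOn f D)) := by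
    simpa using ENNReal.Tendsto.sub (tendsto_const_nhds (x := eVariationOn f D)) h
      (Or.inr ENNReal.zero_ne_top)
  refine tendsto_of_tendsto_of_tendsto_of_le_of_le h2 h1 (fun j => ?_)
    fun j => eVariationOn_le_add_of_sub _ _ _
  rw [tsub_le_iff_right]
  have := eVariationOn_le_add_of_sub f (F j) D
  rwa [← neg_sub, eVariationOn_neg] at this

namespace BV

theorem eVariationOn_sub_le (f g : BV) (D : Set ℝ) :
    eVariationOn (f.toFun - g.toFun) D ≤ ENNReal.ofReal ‖f - g‖ := by
  refine (eVariationOn.mono _ (Set.subset_univ D)).trans ?_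
  exact (ENNReal.le_ofReal_iff_toReal_le (f - g).boundedVariationOn (norm_nonneg _)).2
    (le_add_of_nonneg_left (abs_nonneg (limAtBot (f - g))))

/-- Upper semicontinuity, along a subsequence, of the variation of the maximal function. -/
theorem exists_subseq_eVariationOn_uncenteredMaximal_le {F : ℕ → BV} {f : BV}
    (hF : Tendsto (fun j => ‖F j - f‖) atTop (𝓝 0)) :
    ∃ φ : ℕ → ℕ, StrictMono φ ∧ ∃ ε : ℕ → ℝ≥0∞, Tendsto ε atTop (𝓝 0) ∧ ∀ k,
      eVariationOn (uncenteredMaximal (F (φ k))) Set.univ ≤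
        eVariationOn (uncenteredMaximal f) Set.univ + ε k := by
  obtain ⟨D, hD, hDd, hDc⟩ :=
    exists_countable_dense_continuousAt fun i : Option ℕ => i.elim f F
  have hDf : ∀ x ∈ D, ContinuousAt f x := hDc none
  have hDF : ∀ j, ∀ x ∈ D, ContinuousAt (F j) x := fun j => hDc (some j)
  have hconv : ∀ x, Tendsto (fun j => F j x) atTop (𝓝 (f x)) := fun x =>
    tendsto_iff_dist_tendsto_zero.2
      (squeeze_zero (fun _ => dist_nonneg) (fun j => abs_sub_le_norm (F j) f x) hF)
  have hF' : Tendsto (fun j => ENNReal.ofReal ‖F j - f‖) atTop (𝓝 0) := by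
    simpa using ENNReal.tendsto_ofReal hF
  have hsub : Tendsto (fun j => eVariationOn ((F j).toFun - f.toFun) D) atTop (𝓝 0) :=
    tendsto_of_tendsto_of_tendsto_of_le_of_le tendsto_const_nhds hF' (fun _ => zero_le)
      fun j => eVariationOn_sub_le _ _ _
  have hsub' : Tendsto (fun j => eVariationOn (-(F j).toFun - -f.toFun) D) atTop (𝓝 0) := by
    refine hsub.congr fun j => ?_
    rw [← eVariationOn_neg, neg_sub, neg_sub_neg]
  have hfin : eVariationOn f D ≠ ∞ :=
    ne_top_of_le_ne_top f.boundedVariationOn (eVariationOn.mono _ (Set.subset_univ D))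
  have hfin' : eVariationOn (-f.toFun) D ≠ ∞ := by rwa [eVariationOn_neg]
  have h1 := tendsto_lintegral_levelVar_sub hD (fun x _ => hconv x)
    (tendsto_eVariationOn_of_sub hsub) hfin
  have h2 := tendsto_lintegral_levelVar_sub hD (F := fun j => -(F j).toFun)
    (fun x _ => (hconv x).neg) (tendsto_eVariationOn_of_sub hsub') hfin'
  have hm := fun h => measurable_levelVar hD h
  let H : ℕ → ℝ → ℝ≥0∞ := fun j c => (levelVar D (F j) c - levelVar D f c) +
    (levelVar D (-(F j).toFun) c - levelVar D (-f.toFun) c)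
  have hHm : ∀ j, Measurable (H j) := fun j =>
    ((hm _).sub (hm _)).add ((hm _).sub (hm _))
  have hH : Tendsto (fun j => ∫⁻ c, H j c) atTop (𝓝 0) := by
    have := h1.add h2
    rw [add_zero] at this
    refine this.congr fun j => (lintegral_add_left ((hm _).sub (hm _)) _).symm
  obtain ⟨φ, hφ, hae⟩ := exists_subseq_ae_tendsto_zero hHm hH
  let G : ℝ → ℝ≥0∞ := fun c => levelVar D f c + levelVar D (-f.toFun) c
  let X : ℕ → ℝ → ℝ≥0∞ := fun k c =>
    levelVar D (uncenteredMaximal (F (φ k))) c - levelVar D (uncenteredMaximal f) c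
  have hGfin : ∫⁻ c, G c ≠ ∞ := by
    rw [lintegral_add_left (hm _), lintegral_levelVar hD, lintegral_levelVar hD]
    exact ENNReal.add_ne_top.2 ⟨hfin, hfin'⟩
  have hev : ∀ᵐ c, ∀ᶠ k in atTop, X k c = 0 := by
    have hcount : ∀ᵐ c, ∀ j, c ∉ infLevels D (uncenteredMaximal (F j)) :=
      ae_all_iff.2 fun j => (countable_infLevels hD _).ae_notMem volume
    filter_upwards [hae, hcount, (countable_infLevels hD (uncenteredMaximal f)).ae_notMem volume,
      (hD.image f).ae_notMem volume, (hD.image (-f.toFun)).ae_notMem volume,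
      ae_lt_top ((hm f).add (hm (-f.toFun))) hGfin] with c hc hc4 hc3 hc1 hc2 hcG
    have hfc := ENNReal.add_ne_top.1 hcG.ne
    refine (eventually_levelVar_uncenteredMaximal_le (F := fun k => F (φ k))
      (hF.comp hφ.tendsto_atTop) hD hDd (fun k => hDF _) hDf hc1 hc2 hc3 (fun k => hc4 _)
      hfc.1 hfc.2 ?_ ?_).mono fun k hk => tsub_eq_zero_of_le hk
    · exact tendsto_of_tendsto_of_tendsto_of_le_of_le tendsto_const_nhds hc (fun _ => zero_le)
        fun k => le_self_add
    · exact tendsto_of_tendsto_of_tendsto_of_le_of_le tendsto_const_nhds hc (fun _ => zero_le)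
        fun k => le_add_self
  -- X k is bounded only by H (φ k) + G, which varies with k. Truncating at the integrable G permits
  -- dominated convergence, and the part above G is absorbed by H (φ k), whose integral tends to
  -- zero.
  have hmin : Tendsto (fun k => ∫⁻ c, min (G c) (X k c)) atTop (𝓝 0) := by
    have := tendsto_lintegral_of_dominated_convergence (F := fun k c => min (G c) (X k c))
      (f := fun _ => 0) G (μ := volume)
      (fun k => ((hm _).add (hm _)).min ((hm _).sub (hm _)))
      (fun k => ae_of_all _ fun c => min_le_left _ _) hGfin ?_
    · simpa using this
    · filter_upwards [hev] with c hc
      exact tendsto_const_nhds.congr' (hc.mono fun k hk => by simp [hk])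
  refine ⟨φ, hφ, fun k => ∫⁻ c, H (φ k) c + min (G c) (X k c), ?_, fun k => ?_⟩
  · have := (hH.comp hφ.tendsto_atTop).add hmin
    rw [add_zero] at this
    exact this.congr fun k => (lintegral_add_left (hHm _) _).symm
  · rw [eVariationOn_eq_of_dense hDd (F (φ k)).continuous_uncenteredMaximal,
      eVariationOn_eq_of_dense hDd f.continuous_uncenteredMaximal, ← lintegral_levelVar hD,
      ← lintegral_levelVar hD, ← lintegral_add_left (hm _)]
    refine lintegral_mono fun c => ?_
    have h3 : X k c ≤ H (φ k) c + G c := by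
      refine tsub_le_self.trans (((F (φ k)).levelVar_uncenteredMaximal_le hDd (hDF _) c).trans
        ((levelVar_abs_le D (F (φ k)) c).trans ?_))
      calc _ ≤ (levelVar D f c + (levelVar D (F (φ k)) c - levelVar D f c)) +
            (levelVar D (-f.toFun) c +
              (levelVar D (-(F (φ k)).toFun) c - levelVar D (-f.toFun) c)) :=
            add_le_add le_add_tsub le_add_tsub
        _ = _ := by simp only [H, G]; ring
    calc levelVar D (uncenteredMaximal (F (φ k))) c
        ≤ levelVar D (uncenteredMaximal f) c + X k c := le_add_tsub
      _ ≤ _ := by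
        gcongr
        rw [← min_add_add_left]
        exact le_min h3 le_add_self

end BV

/-! ### Absolute continuity of the maximal function -/

theorem eventually_mem_or_eventually_notMem {A : Set ℝ} {l : Filter ℝ} {r : ℝ}
    (h : Tendsto (A.indicator (1 : ℝ → ℝ)) l (𝓝 r)) : (∀ᶠ x in l, x ∈ A) ∨ ∀ᶠ x in l, x ∉ A := by
  rcases lt_or_ge r (3 / 4) with hr | hr
  · refine Or.inr ((h.eventually_lt_const hr).mono fun x hx hxA => ?_)
    rw [Set.indicator_of_mem hxA, Pi.one_apply] at hx
    linarith
  · refine Or.inl ((h.eventually_const_lt (show 1 / 4 < r by linarith)).mono fun x hx => ?_)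
    by_contra hxA
    rw [Set.indicator_of_notMem hxA] at hx
    linarith

theorem measure_image_eq_zero_of_lipschitz_nhds {u : ℝ → ℝ} {s : Set ℝ}
    (h : ∀ x ∈ s, ∃ K, ∃ t ∈ 𝓝 x, LipschitzOnWith K u t) (hs : volume s = 0) :
    volume (u '' s) = 0 := by
  choose! K t ht hK using h
  obtain ⟨r, hrs, hr, hcov⟩ := TopologicalSpace.countable_cover_nhdsWithin
    (f := t) (s := s) fun x hx => mem_nhdsWithin_of_mem_nhds (ht x hx)
  refine measure_mono_null (t := ⋃ x ∈ r, u '' (s ∩ t x)) ?_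
    ((measure_biUnion_null_iff hr).2 fun x hx => ?_)
  · rintro _ ⟨y, hy, rfl⟩
    obtain ⟨x, hx, hyx⟩ := Set.mem_iUnion₂.1 (hcov hy)
    exact Set.mem_iUnion₂.2 ⟨x, hx, y, ⟨hy, hyx⟩, rfl⟩
  · have h1 := ((hK x (hrs hx)).mono (Set.inter_subset_right (s := s))).hausdorffMeasure_image_le
      zero_le_one
    rw [hausdorffMeasure_real, measure_mono_null Set.inter_subset_left hs, mul_zero] at h1
    exact nonpos_iff_eq_zero.1 h1

theorem eVariationOn_univ_le_of_edist_le {h : ℝ → ℝ} {μ : Measure ℝ}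
    (hμ : ∀ a b, a ≤ b → edist (h b) (h a) ≤ μ (Set.Ioc a b)) :
    eVariationOn h Set.univ ≤ μ Set.univ := by
  refine iSup_le fun ⟨n, u, hu, _⟩ => ?_
  calc ∑ i ∈ Finset.range n, edist (h (u (i + 1))) (h (u i))
      ≤ ∑ i ∈ Finset.range n, μ (Set.Ioc (u i) (u (i + 1))) :=
        Finset.sum_le_sum fun i _ => hμ _ _ (hu (Nat.le_succ i))
    _ = μ (⋃ i ∈ Finset.range n, Set.Ioc (u i) (u (i + 1))) :=
        (measure_biUnion_finset (hu.pairwise_disjoint_on_Ioc_succ.set_pairwise _)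
          fun i _ => measurableSet_Ioc).symm
    _ ≤ μ Set.univ := measure_mono (Set.subset_univ _)

theorem abs_le_of_hasDerivAt_of_abs_sub_le {u v : ℝ → ℝ} {u' v' x : ℝ} (hu : HasDerivAt u u' x)
    (hv : HasDerivAt v v' x) (h : ∀ y, x < y → |u y - u x| ≤ v y - v x) : |u'| ≤ v' := by
  have h1 := (hasDerivAt_iff_tendsto_slope.1 hu).mono_left (nhdsGT_le_nhdsNE x)
  have h2 := (hasDerivAt_iff_tendsto_slope.1 hv).mono_left (nhdsGT_le_nhdsNE x)
  refine le_of_tendsto_of_tendsto h1.abs h2 (eventually_mem_nhdsWithin.mono fun y hy => ?_)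
  have hy' : 0 < y - x := sub_pos.2 hy
  simp only [slope_def_field, abs_div, abs_of_pos hy']
  exact div_le_div_of_nonneg_right (h y hy) hy'.le

/-- |u'| is at most the derivative of the variation function v almost everywhere, and a monotone
function increases by at least the integral of its derivative. -/
theorem setLIntegral_enorm_deriv_le {u : ℝ → ℝ} (hu : BoundedVariationOn u Set.univ) {a b : ℝ}
    (hab : a ≤ b) : ∫⁻ x in Set.Ioc a b, ‖deriv u x‖ₑ ≤ eVariationOn u Set.univ := by
  have hl := hu.locallyBoundedVariationOn
  set v := variationOnFromTo u Set.univ a with hv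
  have hm : Monotone v := monotoneOn_univ.1 (variationOnFromTo.monotoneOn hl (Set.mem_univ a))
  have hsub : ∀ x y, x < y → |u y - u x| ≤ v y - v x := fun x y hxy => by
    have h1 := variationOnFromTo.abs_sub_le_sub_of_le hl (Set.mem_univ a) (Set.mem_univ x)
      (Set.mem_univ y) hxy.le
    exact h1
  have hae : ∀ᵐ x, |deriv u x| ≤ deriv v x := by
    filter_upwards [hl.ae_differentiableAt, hm.ae_differentiableAt] with x h1 h2
    exact abs_le_of_hasDerivAt_of_abs_sub_le h1.hasDerivAt h2.hasDerivAt fun y hy => hsub x y hy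
  have hint : IntervalIntegrable (deriv v) volume a b :=
    (hm.monotoneOn _).intervalIntegrable_deriv
  have h2 := (hm.monotoneOn (Set.uIcc a b)).intervalIntegral_deriv_mem_uIcc
  rw [Set.uIcc_of_le (sub_nonneg.2 (hm hab))] at h2
  calc ∫⁻ x in Set.Ioc a b, ‖deriv u x‖ₑ ≤ ∫⁻ x in Set.Ioc a b, ENNReal.ofReal (deriv v x) := by
        refine lintegral_mono_ae (ae_restrict_of_ae (hae.mono fun x hx => ?_))
        rw [Real.enorm_eq_ofReal_abs]
        exact ENNReal.ofReal_le_ofReal hx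
    _ = ENNReal.ofReal (∫ x in Set.Ioc a b, deriv v x) := by
        refine (ofReal_integral_eq_lintegral_ofReal
          ((intervalIntegrable_iff_integrableOn_Ioc_of_le hab).1 hint) ?_).symm
        exact ae_restrict_of_ae (hae.mono fun x hx => (abs_nonneg _).trans hx)
    _ ≤ ENNReal.ofReal (v b - v a) := by
        rw [← intervalIntegral.integral_of_le hab]
        exact ENNReal.ofReal_le_ofReal h2.2
    _ ≤ eVariationOn u Set.univ := by
        rw [hv, variationOnFromTo.self, sub_zero, variationOnFromTo.eq_of_le _ _ hab]
        exact ENNReal.ofReal_toReal_le.trans (eVariationOn.mono _ Set.inter_subset_left)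

/-- The derivative of a function of bounded variation is bounded in mean by the variation. -/
theorem lintegral_enorm_deriv_le {u : ℝ → ℝ} (hu : BoundedVariationOn u Set.univ) :
    ∫⁻ x, ‖deriv u x‖ₑ ≤ eVariationOn u Set.univ := by
  have hcov : (⋃ n : ℕ, Set.Ioc (-(n : ℝ)) n) = Set.univ := by
    refine Set.eq_univ_of_forall fun x => Set.mem_iUnion.2 ?_
    obtain ⟨n, hn⟩ := exists_nat_gt |x|
    exact ⟨n, (abs_lt.1 hn).1, (abs_lt.1 hn).2.le⟩
  have hmono : Monotone fun n : ℕ => Set.Ioc (-(n : ℝ)) n := fun m n hmn =>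
    Set.Ioc_subset_Ioc (neg_le_neg (Nat.cast_le.2 hmn)) (Nat.cast_le.2 hmn)
  have h1 : ∫⁻ x, ‖deriv u x‖ₑ = ∫⁻ x in ⋃ n : ℕ, Set.Ioc (-(n : ℝ)) n, ‖deriv u x‖ₑ := by
    rw [hcov, setLIntegral_univ]
  rw [h1, setLIntegral_iUnion_of_directed _ hmono.directed_le]
  exact iSup_le fun n => setLIntegral_enorm_deriv_le hu (by linarith [n.cast_nonneg (α := ℝ)])

theorem integrable_deriv {u : ℝ → ℝ} (hu : BoundedVariationOn u Set.univ) :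
    Integrable (deriv u) :=
  ⟨(measurable_deriv u).aestronglyMeasurable, (lintegral_enorm_deriv_le hu).trans_lt hu.lt_top⟩

theorem absolutelyContinuousOnInterval_of_dist_le {h g : ℝ → ℝ} (hg : Integrable g)
    (hle : ∀ a b, a ≤ b → |h b - h a| ≤ ∫ x in a..b, g x) (a b : ℝ) :
    AbsolutelyContinuousOnInterval h a b := by
  have h1 := (hg.intervalIntegrable (a := a)
    (b := b)).absolutelyContinuousOnInterval_intervalIntegral Set.left_mem_uIcc
  refine squeeze_zero (fun t => Finset.sum_nonneg fun i _ => dist_nonneg)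
    (fun t => Finset.sum_le_sum fun i _ => ?_) h1
  have key : ∀ x y, x ≤ y → dist (h x) (h y) ≤ dist (∫ v in a..x, g v) (∫ v in a..y, g v) := by
    intro x y hxy
    rw [dist_comm, Real.dist_eq, dist_comm, Real.dist_eq,
      intervalIntegral.integral_interval_sub_left hg.intervalIntegrable hg.intervalIntegrable]
    exact (hle x y hxy).trans (le_abs_self _)
  rcases le_total (t.2 i).1 (t.2 i).2 with hxy | hxy
  · exact key _ _ hxy
  · rw [dist_comm, dist_comm (∫ v in a..(t.2 i).1, g v)]
    exact key _ _ hxy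

theorem eVariationOn_le_lintegral_enorm_deriv {h : ℝ → ℝ}
    (hac : ∀ a b, AbsolutelyContinuousOnInterval h a b) :
    eVariationOn h Set.univ ≤ ∫⁻ x, ‖deriv h x‖ₑ := by
  have := eVariationOn_univ_le_of_edist_le (h := h)
    (μ := volume.withDensity fun x => ‖deriv h x‖ₑ) fun a b hab => by
      rw [withDensity_apply _ measurableSet_Ioc, edist_dist, Real.dist_eq,
        ← (hac a b).integral_deriv_eq_sub, intervalIntegral.integral_of_le hab,
        ← Real.enorm_eq_ofReal_abs]
      exact enorm_integral_le_lintegral_enorm _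
  rwa [withDensity_apply _ MeasurableSet.univ, setLIntegral_univ] at this

namespace BV

/-- Almost everywhere continuity gives |f| ≥ c almost everywhere on the interval; continuity at one
point of D gives a strict gain on a subinterval, so the average exceeds c strictly. -/
theorem lt_uncenteredMaximal_of_dense (f : BV) {D : Set ℝ} (hD : Dense D)
    (hDc : ∀ x ∈ D, ContinuousAt f x) {a b c x : ℝ} (hab : a < b) (ha : a ≤ x) (hb : x ≤ b)
    (h : ∀ d ∈ D, d ∈ Set.Ioo a b → c < |f d|) : c < uncenteredMaximal f x := by
  obtain ⟨d, hdD, hd⟩ := hD.exists_between hab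
  obtain ⟨c', hc, hc'⟩ := exists_between (h d hdD hd)
  obtain ⟨p, q, hpq, hsub⟩ := mem_nhds_iff_exists_Ioo_subset.1
    (inter_mem ((hDc d hdD).abs.eventually_const_lt hc') (isOpen_Ioo.mem_nhds hd))
  have hpq' : p < q := hpq.1.trans hpq.2
  obtain ⟨hap, hqb⟩ := (Set.Ioo_subset_Ioo_iff hpq').1 (hsub.trans Set.inter_subset_right)
  have hae : ∀ᵐ t, t ∈ Set.Ioo a b → c ≤ |f t| := by
    filter_upwards [f.ae_continuousAt] with t ht htab
    have := le_on_closure_of_dense (h := fun x => -|f x|) (c := -c) hD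
      (fun y hy hy' => neg_le_neg (h y hy hy').le) htab ht.abs.neg
    linarith
  have h1 := mul_le_integral (f := f) hap (c := c)
    (hae.mono fun t ht htm => ht ⟨htm.1, htm.2.trans_le (hpq'.le.trans hqb)⟩)
  have h2 := mul_le_integral (f := f) hpq'.le (c := c')
    (ae_of_all _ fun t ht => (hsub ht).1.le)
  have h3 := mul_le_integral (f := f) hqb (c := c)
    (hae.mono fun t ht htm => ht ⟨(hap.trans hpq'.le).trans_lt htm.1, htm.2⟩)
  have h4 := f.integral_le ha hb
  rw [← intervalIntegral.integral_add_adjacent_intervals (f.intervalIntegrable_abs a q)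
    (f.intervalIntegrable_abs q b), ← intervalIntegral.integral_add_adjacent_intervals
    (f.intervalIntegrable_abs a p) (f.intervalIntegrable_abs p q)] at h4
  have h5 : (q - p) * c < (q - p) * c' := mul_lt_mul_of_pos_left hc (sub_pos.2 hpq')
  have h6 : (b - a) * c < (b - a) * uncenteredMaximal f x := by linarith
  exact lt_of_mul_lt_mul_left h6 (by linarith)

theorem abs_eq_of_notMem_detachedSet {f : BV} {x : ℝ} (hx : x ∉ f.detachedSet)
    (hf : ContinuousAt f x) : |f x| = uncenteredMaximal f x := by
  refine (abs_le_uncenteredMaximal hf).eq_of_not_lt fun hlt => hx ?_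
  obtain ⟨c, h1, h2⟩ := exists_between hlt
  obtain ⟨η, hη, h⟩ := Metric.mem_nhds_iff.1 (hf.abs.eventually_lt_const h1)
  exact ⟨c, h2, η, hη, ae_of_all _ fun t ht =>
    (show |f t| < c from h (by rwa [Metric.mem_ball, Real.dist_eq])).le⟩

/-- The maximal function maps the complement of the detached set to a null set. -/
theorem volume_image_compl_detachedSet (f : BV) :
    volume (uncenteredMaximal f '' f.detachedSetᶜ) = 0 := by
  obtain ⟨D, hD, hDd, hDc⟩ := exists_countable_dense_continuousAt fun _ : Unit => f
  have hDc := hDc ()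
  have hfin : ∫⁻ c, levelVar D (fun x => |f x|) c ≠ ∞ := by
    rw [lintegral_levelVar hD]
    exact ne_top_of_le_ne_top f.boundedVariationOn
      ((eVariationOn_abs_le D f).trans (eVariationOn.mono _ (Set.subset_univ D)))
  -- Off countably many values, a point x outside the detached set is a continuity point of f with
  -- |f(x)| = M̃f(x) = c. For almost every c it will be a local maximum of |f| along D, which forces
  -- c into this countable set of suprema over rational intervals.
  let S : Set ℝ := Set.range fun p : ℚ × ℚ => sSup ((fun x => |f x|) '' (D ∩ Set.Ioo (p.1 : ℝ) p.2))
  have hS : S.Countable := Set.countable_range _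
  refine measure_eq_zero_iff_ae_notMem.2 ?_
  filter_upwards [ae_lt_top (measurable_levelVar hD _) hfin, hS.ae_notMem volume,
    (f.countable_not_continuousAt.image (uncenteredMaximal f)).ae_notMem volume]
    with c hc hcS hcd
  rintro ⟨x, hx, rfl⟩
  have hfx : ContinuousAt f x := by
    by_contra hn
    exact hcd ⟨x, hn, rfl⟩
  have habs := abs_eq_of_notMem_detachedSet hx hfx
  set c := uncenteredMaximal f x with hcdef
  have hbv : BoundedVariationOn ({y | c < |f y|}.indicator (1 : ℝ → ℝ)) D := hc.ne
  -- Finite level variation makes the indicator of {|f| > c} eventually constant along D on each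
  -- side of x. The constant cannot be 1, as that would give M̃f(x) > c.
  have hright : ∃ b > x, ∀ d ∈ D, d ∈ Set.Ioo x b → |f d| ≤ c := by
    obtain ⟨r, hr⟩ := hbv.exists_tendsto_right x
    rcases eventually_mem_or_eventually_notMem hr with h | h
    · rw [Set.inter_comm, nhdsWithin_inter', eventually_inf_principal] at h
      obtain ⟨b, hb, hsub⟩ := mem_nhdsGT_iff_exists_Ioo_subset.1 h
      exact absurd (f.lt_uncenteredMaximal_of_dense hDd hDc (Set.mem_Ioi.1 hb) le_rfl
        (le_of_lt hb) fun d hd hdx => hsub hdx hd) (lt_irrefl _)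
    · rw [Set.inter_comm, nhdsWithin_inter', eventually_inf_principal] at h
      obtain ⟨b, hb, hsub⟩ := mem_nhdsGT_iff_exists_Ioo_subset.1 h
      exact ⟨b, hb, fun d hd hdx => not_lt.1 (hsub hdx hd)⟩
  have hleft : ∃ a < x, ∀ d ∈ D, d ∈ Set.Ioo a x → |f d| ≤ c := by
    obtain ⟨r, hr⟩ := hbv.exists_tendsto_left x
    rcases eventually_mem_or_eventually_notMem hr with h | h
    · rw [Set.inter_comm, nhdsWithin_inter', eventually_inf_principal] at h
      obtain ⟨a, ha, hsub⟩ := mem_nhdsLT_iff_exists_Ioo_subset.1 h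
      exact absurd (f.lt_uncenteredMaximal_of_dense hDd hDc (Set.mem_Iio.1 ha) (le_of_lt ha)
        le_rfl fun d hd hdx => hsub hdx hd) (lt_irrefl _)
    · rw [Set.inter_comm, nhdsWithin_inter', eventually_inf_principal] at h
      obtain ⟨a, ha, hsub⟩ := mem_nhdsLT_iff_exists_Ioo_subset.1 h
      exact ⟨a, ha, fun d hd hdx => not_lt.1 (hsub hdx hd)⟩
  obtain ⟨b, hxb, hb⟩ := hright
  obtain ⟨a, hax, ha⟩ := hleft
  obtain ⟨p, hap, hpx⟩ := exists_rat_btwn hax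
  obtain ⟨q, hxq, hqb⟩ := exists_rat_btwn hxb
  refine hcS ⟨(p, q), IsLUB.csSup_eq ⟨?_, fun s hs => ?_⟩ ?_⟩
  · rintro _ ⟨d, ⟨hdD, hdp, hdq⟩, rfl⟩
    rcases lt_trichotomy d x with h | rfl | h
    · exact ha d hdD ⟨hap.trans hdp, h⟩
    · exact habs.le
    · exact hb d hdD ⟨h, hdq.trans hqb⟩
  · rw [← habs]
    exact le_on_closure_of_dense (h := fun x => |f x|) hDd
      (fun y hy hy' => hs ⟨y, ⟨hy, hy'⟩, rfl⟩) ⟨hpx, hxq⟩ hfx.abs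
  · obtain ⟨d, hd, hd'⟩ := hDd.exists_between (hpx.trans hxq)
    exact ⟨_, d, ⟨hd, hd'⟩, rfl⟩

theorem ae_differentiableAt_uncenteredMaximal (f : BV) :
    ∀ᵐ x, DifferentiableAt ℝ (uncenteredMaximal f) x :=
  f.boundedVariationOn_uncenteredMaximal.locallyBoundedVariationOn.ae_differentiableAt

/-- The values on [a, b] cover the interval between U(a) and U(b). The complement of the detached
set has null image, and so do the nondifferentiability points in it, as U is locally Lipschitz
there. The remaining image is bounded by the area inequality. -/
theorem edist_uncenteredMaximal_le (f : BV) {a b : ℝ} (hab : a ≤ b) :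
    edist (uncenteredMaximal f b) (uncenteredMaximal f a) ≤
      ∫⁻ x in Set.Ioc a b ∩ f.detachedSet, ‖deriv (uncenteredMaximal f) x‖ₑ := by
  set U := uncenteredMaximal f with hU
  set O := f.detachedSet with hO
  have hOo : IsOpen O := f.isOpen_detachedSet
  set s := (Set.Icc a b ∩ O) ∩ {x | DifferentiableAt ℝ U x} with hs
  have hsm : MeasurableSet s :=
    (measurableSet_Icc.inter hOo.measurableSet).inter (measurableSet_of_differentiableAt ℝ U)
  have hcov : Set.uIcc (U a) (U b) ⊆
      U '' Oᶜ ∪ (U '' s ∪ U '' (O ∩ {x | ¬ DifferentiableAt ℝ U x})) := by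
    refine (intermediate_value_uIcc f.continuous_uncenteredMaximal.continuousOn).trans ?_
    rintro _ ⟨x, hx, rfl⟩
    rw [Set.uIcc_of_le hab] at hx
    by_cases h1 : x ∈ O
    · by_cases h2 : DifferentiableAt ℝ U x
      · exact Or.inr (Or.inl ⟨x, ⟨⟨hx, h1⟩, h2⟩, rfl⟩)
      · exact Or.inr (Or.inr ⟨x, ⟨h1, h2⟩, rfl⟩)
    · exact Or.inl ⟨x, h1, rfl⟩
  have hnull : volume (U '' (O ∩ {x | ¬ DifferentiableAt ℝ U x})) = 0 :=
    measure_image_eq_zero_of_lipschitz_nhds (fun x hx => f.exists_lipschitzOnWith hx.1)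
      (measure_mono_null Set.inter_subset_right (ae_iff.1 f.ae_differentiableAt_uncenteredMaximal))
  have h1 : edist (U b) (U a) = volume (Set.uIcc (U a) (U b)) := by
    rw [Set.uIcc, Real.volume_Icc, max_sub_min_eq_abs, edist_dist, Real.dist_eq]
  rw [h1]
  calc volume (Set.uIcc (U a) (U b)) ≤ 0 + (volume (U '' s) + 0) := by
        refine (measure_mono hcov).trans ((measure_union_le _ _).trans ?_)
        rw [f.volume_image_compl_detachedSet]
        gcongr
        refine (measure_union_le _ _).trans ?_
        rw [hnull]
    _ = volume (U '' s) := by simp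
    _ ≤ ∫⁻ x in s, ‖deriv U x‖ₑ := by
        have := addHaar_image_le_lintegral_abs_det_fderiv volume hsm (f := U)
          (f' := fun x => ContinuousLinearMap.toSpanSingleton ℝ (deriv U x)) fun x hx =>
            (hx.2.hasDerivAt.hasFDerivAt).hasFDerivWithinAt
        simpa [ContinuousLinearMap.det_toSpanSingleton, Real.enorm_eq_ofReal_abs] using this
    _ ≤ ∫⁻ x in Set.Icc a b ∩ O, ‖deriv U x‖ₑ := lintegral_mono_set Set.inter_subset_left
    _ = _ := setLIntegral_congr (Ioc_ae_eq_Icc.symm.inter ae_eq_rfl)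

theorem absolutelyContinuousOnInterval_uncenteredMaximal (f : BV) (a b : ℝ) :
    AbsolutelyContinuousOnInterval (uncenteredMaximal f) a b := by
  have hint := integrable_deriv f.boundedVariationOn_uncenteredMaximal
  refine absolutelyContinuousOnInterval_of_dist_le hint.norm (fun a b hab => ?_) a b
  have h1 := (f.edist_uncenteredMaximal_le hab).trans (lintegral_mono_set Set.inter_subset_left)
  rw [← ofReal_integral_norm_eq_lintegral_enorm hint.integrableOn, edist_dist, Real.dist_eq,
    ENNReal.ofReal_le_ofReal_iff (integral_nonneg fun _ => norm_nonneg _)] at h1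
  rwa [intervalIntegral.integral_of_le hab]

/-- The variation is at most the integral of |U'| over the detached set and at least its integral
over the whole line, so the finite difference of the two vanishes. -/
theorem ae_deriv_eq_zero_of_notMem_detachedSet (f : BV) :
    ∀ᵐ x, x ∉ f.detachedSet → deriv (uncenteredMaximal f) x = 0 := by
  have hOm := f.isOpen_detachedSet.measurableSet
  have hbv := f.boundedVariationOn_uncenteredMaximal
  have h1 := eVariationOn_univ_le_of_edist_le (h := uncenteredMaximal f)
    (μ := (volume.restrict f.detachedSet).withDensity fun x => ‖deriv (uncenteredMaximal f) x‖ₑ)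
    fun a b hab => by
      rw [withDensity_apply _ measurableSet_Ioc, Measure.restrict_restrict measurableSet_Ioc]
      exact f.edist_uncenteredMaximal_le hab
  rw [withDensity_apply _ MeasurableSet.univ, setLIntegral_univ] at h1
  have h2 := lintegral_enorm_deriv_le hbv
  rw [← lintegral_add_compl _ hOm] at h2
  have h3 : ∫⁻ x in f.detachedSetᶜ, ‖deriv (uncenteredMaximal f) x‖ₑ = 0 := by
    have hfin : ∫⁻ x in f.detachedSet, ‖deriv (uncenteredMaximal f) x‖ₑ ≠ ∞ :=
      ne_top_of_le_ne_top hbv (le_self_add.trans h2)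
    have h4 := h2.trans h1
    exact nonpos_iff_eq_zero.1 ((ENNReal.add_le_add_iff_left hfin).1 (by simpa using h4))
  rw [lintegral_eq_zero_iff (measurable_deriv _).enorm, Filter.EventuallyEq,
    ae_restrict_iff' hOm.compl] at h3
  exact h3.mono fun x hx hxO => enorm_eq_zero.1 (hx hxO)

end BV

/-! ### Optimal intervals and convergence of derivatives -/

namespace BV

/-- The average of `|f|` over the interval with endpoints `x` and `x + r⁻¹`, on either side of `x`,
is at most the maximal function, up to the usual enlargement factor. -/
theorem mul_integral_le (f : BV) (x y : ℝ) {r : ℝ} (hr : r ≠ 0) :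
    r * ∫ t in x..(x + r⁻¹), |f t| ≤ (1 + |x - y| * |r|) * uncenteredMaximal f y := by
  rcases lt_or_gt_of_ne hr with h | h
  · have h1 := f.integral_le_add (a := x + r⁻¹) (b := x) (x := x)
      (by linarith [inv_lt_zero.2 h]) le_rfl y
    rw [intervalIntegral.integral_symm, mul_neg, ← neg_mul]
    refine (mul_le_mul_of_nonneg_left h1 (by linarith)).trans (le_of_eq ?_)
    rw [abs_of_neg h]
    field_simp
    ring
  · have h1 := f.integral_le_add (a := x) (b := x + r⁻¹) (x := x) le_rfl
      (by linarith [inv_pos.2 h]) y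
    refine (mul_le_mul_of_nonneg_left h1 h.le).trans (le_of_eq ?_)
    rw [abs_of_pos h]
    field_simp
    ring

/-- The interval between `x` and `x + r⁻¹` (a half-line if `r = 0`) realizes the maximal function
at `x` up to `ε`. -/
def IsNearOptimal (f : BV) (x r ε : ℝ) : Prop :=
  (r ≠ 0 → uncenteredMaximal f x - ε ≤ r * ∫ t in x..(x + r⁻¹), |f t|) ∧
    ∀ y, uncenteredMaximal f x - ε ≤ (1 + |x - y| * |r|) * uncenteredMaximal f y

theorem tendsto_uncenteredMaximal {F : ℕ → BV} {f : BV}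
    (hF : Tendsto (fun j => ‖F j - f‖) atTop (𝓝 0)) (x : ℝ) :
    Tendsto (fun j => uncenteredMaximal (F j) x) atTop (𝓝 (uncenteredMaximal f x)) :=
  tendsto_iff_dist_tendsto_zero.2 (squeeze_zero (fun _ => dist_nonneg)
    (fun j => abs_uncenteredMaximal_sub_le (F j) f (abs_sub_le_norm (F j) f) x) hF)

theorem tendsto_apply {F : ℕ → BV} {f : BV} (hF : Tendsto (fun j => ‖F j - f‖) atTop (𝓝 0))
    (x : ℝ) : Tendsto (fun j => F j x) atTop (𝓝 (f x)) :=
  tendsto_iff_dist_tendsto_zero.2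
    (squeeze_zero (fun _ => dist_nonneg) (fun j => abs_sub_le_norm (F j) f x) hF)

theorem abs_integral_sub_le (f g : BV) (a b : ℝ) :
    |(∫ t in a..b, |f t|) - (∫ t in a..b, |g t|)| ≤ ‖f - g‖ * |b - a| := by
  rw [← intervalIntegral.integral_sub (f.intervalIntegrable_abs a b)
    (g.intervalIntegrable_abs a b), ← Real.norm_eq_abs]
  exact intervalIntegral.norm_integral_le_of_norm_le_const fun t _ =>
    (abs_abs_sub_abs_le_abs_sub _ _).trans (abs_sub_le_norm f g t)

/-- With the signed reciprocal length as parameter, infinitely long intervals correspond to r = 0.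
The first condition passes to the limit for r ≠ 0; the second makes no reference to an interval and
also survives at r = 0, where it says that x minimizes M̃f. -/
theorem IsNearOptimal.of_tendsto {F : ℕ → BV} {f : BV}
    (hF : Tendsto (fun j => ‖F j - f‖) atTop (𝓝 0)) {x r : ℝ} {s ε : ℕ → ℝ}
    (hs : Tendsto s atTop (𝓝 r)) (hε : Tendsto ε atTop (𝓝 0))
    (h : ∀ᶠ j in atTop, (F j).IsNearOptimal x (s j) (ε j)) : f.IsNearOptimal x r 0 := by
  have hU := tendsto_uncenteredMaximal hF
  refine ⟨fun hr => ?_, fun y => ?_⟩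
  · have hprim : Continuous fun b => ∫ t in x..b, |f t| :=
      intervalIntegral.continuous_primitive f.intervalIntegrable_abs x
    have h1 : Tendsto (fun j => s j * (∫ t in x..(x + (s j)⁻¹), |f t|) + ‖F j - f‖) atTop
        (𝓝 (r * (∫ t in x..(x + r⁻¹), |f t|) + 0)) :=
      (hs.mul ((hprim.tendsto _).comp (tendsto_const_nhds.add (hs.inv₀ hr)))).add hF
    have h2 := (hU x).sub hε
    rw [add_zero] at h1
    refine le_of_tendsto_of_tendsto h2 h1 ?_
    filter_upwards [h, hs.eventually_ne hr] with j hj hne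
    refine (hj.1 hne).trans ?_
    have h3 := abs_integral_sub_le (F j) f x (x + (s j)⁻¹)
    rw [add_sub_cancel_left] at h3
    have h4 : s j * ((∫ t in x..(x + (s j)⁻¹), |F j t|) - ∫ t in x..(x + (s j)⁻¹), |f t|) ≤
        ‖F j - f‖ := by
      refine (le_abs_self _).trans ?_
      rw [abs_mul]
      refine (mul_le_mul_of_nonneg_left h3 (abs_nonneg _)).trans (le_of_eq ?_)
      rw [mul_left_comm, ← abs_mul, mul_inv_cancel₀ hne, abs_one, mul_one]
    linarith
  · have h1 : Tendsto (fun j => (1 + |x - y| * |s j|) * uncenteredMaximal (F j) y) atTop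
        (𝓝 ((1 + |x - y| * |r|) * uncenteredMaximal f y)) :=
      (tendsto_const_nhds.add (tendsto_const_nhds.mul hs.abs)).mul (hU y)
    exact le_of_tendsto_of_tendsto ((hU x).sub hε) h1 (h.mono fun j hj => hj.2 y)

/-- Cutting a good interval at x leaves a half whose average is at least as good. That half must
leave the η-neighbourhood, where |f| ≤ c, so its reciprocal length is at most 1/η. -/
theorem exists_isNearOptimal (f : BV) {x c η : ℝ} (hc : c < uncenteredMaximal f x) (hη : 0 < η)
    (h : ∀ᵐ t, |t - x| < η → |f t| ≤ c) {ε : ℝ} (hε : 0 < ε) :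
    ∃ r, |r| ≤ η⁻¹ ∧ f.IsNearOptimal x r ε := by
  suffices ∃ r, r ≠ 0 ∧ |r| ≤ η⁻¹ ∧
      uncenteredMaximal f x - ε ≤ r * ∫ t in x..(x + r⁻¹), |f t| by
    obtain ⟨r, hr0, hr, hle⟩ := this
    exact ⟨r, hr, fun _ => hle, fun y => hle.trans (f.mul_integral_le x y hr0)⟩
  obtain ⟨a, b, ha, hb, hab⟩ := f.exists_lt_integral
    (max_lt hc (sub_lt_self (uncenteredMaximal f x) hε))
  set c' := max c (uncenteredMaximal f x - ε)
  have hcc' : c ≤ c' := le_max_left _ _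
  rw [← intervalIntegral.integral_add_adjacent_intervals (f.intervalIntegrable_abs a x)
    (f.intervalIntegrable_abs x b)] at hab
  rcases lt_or_ge ((b - x) * c') (∫ t in x..b, |f t|) with h1 | h1
  · have hbx : 0 < b - x := sub_pos.2 hb
    have hlen : η ≤ b - x := by
      by_contra! hlt
      have h2 := integral_le_mul (f := f) hb.le (c := c) (h.mono fun t ht htm => ht (by
        rw [abs_lt]; exact ⟨by linarith [htm.1], by linarith [htm.2]⟩))
      nlinarith
    refine ⟨(b - x)⁻¹, by positivity, ?_, (le_max_right c _).trans ?_⟩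
    · rw [abs_of_pos (by positivity)]
      exact inv_anti₀ hη hlen
    · rw [inv_inv, add_sub_cancel, le_inv_mul_iff₀ hbx]
      exact h1.le
  · have h1 : (x - a) * c' < ∫ t in a..x, |f t| := by linarith
    have hax : 0 < x - a := sub_pos.2 ha
    have hlen : η ≤ x - a := by
      by_contra! hlt
      have h2 := integral_le_mul (f := f) ha.le (c := c) (h.mono fun t ht htm => ht (by
        rw [abs_lt]; exact ⟨by linarith [htm.1], by linarith [htm.2]⟩))
      nlinarith
    have hneg : a - x ≠ 0 := by linarith
    refine ⟨(a - x)⁻¹, inv_ne_zero hneg, ?_, (le_max_right c _).trans ?_⟩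
    · rw [abs_inv, abs_sub_comm, abs_of_pos hax]
      exact inv_anti₀ hη hlen
    · rw [inv_inv, add_sub_cancel, intervalIntegral.integral_symm, mul_neg, ← neg_mul, ← inv_neg,
        neg_sub, le_inv_mul_iff₀ hax]
      exact h1.le

theorem exists_isOptimal (f : BV) {x c η : ℝ} (hc : c < uncenteredMaximal f x) (hη : 0 < η)
    (h : ∀ᵐ t, |t - x| < η → |f t| ≤ c) : ∃ r, |r| ≤ η⁻¹ ∧ f.IsNearOptimal x r 0 := by
  choose s hs hs' using fun n : ℕ =>
    f.exists_isNearOptimal hc hη h (Nat.one_div_pos_of_nat (α := ℝ) (n := n))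
  obtain ⟨r, hr, φ, hφ, hlim⟩ := (isCompact_Icc (a := -η⁻¹) (b := η⁻¹)).tendsto_subseq
    fun n => _root_.abs_le.1 (hs n)
  refine ⟨r, _root_.abs_le.2 hr, IsNearOptimal.of_tendsto (F := fun _ => f) (by simp) hlim
    (tendsto_one_div_add_atTop_nhds_zero_nat.comp hφ.tendsto_atTop)
    (Eventually.of_forall fun n => hs' _)⟩

/-- With the other endpoint b fixed, M̃f(y) minus the average of |f| between y and b is nonnegative
near x and zero at x, so its derivative vanishes there. For r = 0 the point x is a minimum of M̃f
itself. -/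
theorem IsNearOptimal.deriv_eq {f : BV} {x r : ℝ} (h : f.IsNearOptimal x r 0)
    (hf : ContinuousAt f x) (hd : DifferentiableAt ℝ (uncenteredMaximal f) x) :
    deriv (uncenteredMaximal f) x = (uncenteredMaximal f x - |f x|) * r := by
  rcases eq_or_ne r 0 with rfl | hr
  · rw [mul_zero]
    refine IsLocalMin.deriv_eq_zero (Eventually.of_forall fun y => ?_)
    simpa using h.2 y
  set b := x + r⁻¹ with hb
  have hbx : b - x = r⁻¹ := by simp [hb]
  have hbx0 : b - x ≠ 0 := hbx ▸ inv_ne_zero hr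
  have hI : HasDerivAt (fun y => ∫ t in y..b, |f t|) (-|f x|) x :=
    intervalIntegral.integral_hasDerivAt_left (f.intervalIntegrable_abs x b)
      (f.measurable.abs.stronglyMeasurable.stronglyMeasurableAtFilter) hf.abs
  have hinv : HasDerivAt (fun y => (b - y)⁻¹) (-(-1) / (b - x) ^ 2) x :=
    ((hasDerivAt_id x).const_sub b).inv hbx0
  have hψ := hd.hasDerivAt.sub (hinv.mul hI)
  have hval : uncenteredMaximal f x = r * ∫ t in x..b, |f t| := by
    refine le_antisymm (by simpa using h.1 hr) ?_
    simpa using f.mul_integral_le x x hr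
  have hmin : IsLocalMin (uncenteredMaximal f - (fun y => (b - y)⁻¹) * fun y => ∫ t in y..b, |f t|)
      x := by
    have hne : ∀ᶠ y in 𝓝 x, b - y ≠ 0 :=
      (continuous_const.sub continuous_id).continuousAt.eventually_ne hbx0
    filter_upwards [hne] with y hy
    simp only [Pi.sub_apply, Pi.mul_apply]
    rw [hbx, inv_inv, ← hval, sub_self, sub_nonneg]
    have := f.mul_integral_le y y (inv_ne_zero hy)
    simpa using this
  have h0 := hmin.hasDerivAt_eq_zero hψ
  rw [hbx, inv_inv] at h0
  have h1 : -(-1) / r⁻¹ ^ 2 = r ^ 2 := by field_simp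
  rw [h1] at h0
  rw [sub_mul, hval]
  linear_combination h0

/-- Convergence of the derivatives of the maximal functions on the detached set. -/
theorem tendsto_deriv_uncenteredMaximal {F : ℕ → BV} {f : BV}
    (hF : Tendsto (fun j => ‖F j - f‖) atTop (𝓝 0)) {x : ℝ} (hx : x ∈ f.detachedSet)
    (hf : ContinuousAt f x) (hFc : ∀ j, ContinuousAt (F j) x)
    (hd : DifferentiableAt ℝ (uncenteredMaximal f) x)
    (hFd : ∀ j, DifferentiableAt ℝ (uncenteredMaximal (F j)) x) :
    Tendsto (fun j => deriv (uncenteredMaximal (F j)) x) atTop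
      (𝓝 (deriv (uncenteredMaximal f) x)) := by
  obtain ⟨c, hc, η, hη, h⟩ := hx
  have hev : ∀ᶠ j in atTop, ∃ r, |r| ≤ η⁻¹ ∧ (F j).IsNearOptimal x r 0 := by
    filter_upwards [hF.eventually_lt_const (show 0 < (uncenteredMaximal f x - c) / 2 by linarith)]
      with j hj
    have h1 := _root_.abs_le.1 (abs_uncenteredMaximal_sub_le (F j) f (abs_sub_le_norm (F j) f) x)
    refine (F j).exists_isOptimal (c := c + ‖F j - f‖) (by linarith) hη (h.mono fun t ht htx => ?_)
    have h2 := ht htx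
    have h3 := abs_sub_abs_le_abs_sub (F j t) (f t)
    have h4 := abs_sub_le_norm (F j) f t
    linarith
  -- Where no optimal parameter exists, which happens for finitely many j at most, the value 0 keeps
  -- the sequence in the compact interval.
  have hchoice : ∀ j, ∃ r, |r| ≤ η⁻¹ ∧
      ((∃ r, |r| ≤ η⁻¹ ∧ (F j).IsNearOptimal x r 0) → (F j).IsNearOptimal x r 0) := by
    intro j
    by_cases hj : ∃ r, |r| ≤ η⁻¹ ∧ (F j).IsNearOptimal x r 0
    · obtain ⟨r, hr, hr'⟩ := hj
      exact ⟨r, hr, fun _ => hr'⟩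
    · exact ⟨0, by simpa using hη.le, fun h => absurd h hj⟩
  choose s hs hs' using hchoice
  refine tendsto_of_subseq_tendsto fun ns hns => ?_
  obtain ⟨r, -, φ, hφ, hlim⟩ := (isCompact_Icc (a := -η⁻¹) (b := η⁻¹)).tendsto_subseq
    fun n => _root_.abs_le.1 (hs (ns n))
  refine ⟨φ, ?_⟩
  have hsub : Tendsto (fun n => ns (φ n)) atTop atTop := hns.comp hφ.tendsto_atTop
  have hF' : Tendsto (fun n => ‖F (ns (φ n)) - f‖) atTop (𝓝 0) := hF.comp hsub
  have hopt : ∀ᶠ n in atTop, (F (ns (φ n))).IsNearOptimal x (s (ns (φ n))) 0 :=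
    (hsub.eventually hev).mono fun n hn => hs' _ hn
  have hr : f.IsNearOptimal x r 0 := IsNearOptimal.of_tendsto hF' hlim tendsto_const_nhds hopt
  rw [hr.deriv_eq hf hd]
  refine (((tendsto_uncenteredMaximal hF' x).sub (tendsto_apply hF' x).abs).mul hlim).congr' ?_
  filter_upwards [hopt] with n hn
  exact (hn.deriv_eq (hFc _) (hFd _)).symm

end BV

/-! ### Convergence in L¹ and continuity -/

/-- A Riesz–Scheffé lemma: almost everywhere convergence where the limit does not vanish, together
with upper semicontinuity of the norms, yields convergence in mean. -/
theorem tendsto_lintegral_enorm_sub_of_le {g : ℕ → ℝ → ℝ} {h : ℝ → ℝ} (hg : ∀ k, Measurable (g k))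
    (hh : Measurable h) (hfin : ∫⁻ x, ‖h x‖ₑ ≠ ∞) {ε : ℕ → ℝ≥0∞} (hε : Tendsto ε atTop (𝓝 0))
    (hle : ∀ k, ∫⁻ x, ‖g k x‖ₑ ≤ (∫⁻ x, ‖h x‖ₑ) + ε k)
    (hae : ∀ᵐ x, h x ≠ 0 → Tendsto (fun k => g k x) atTop (𝓝 (h x))) :
    Tendsto (fun k => ∫⁻ x, ‖g k x - h x‖ₑ) atTop (𝓝 0) := by
  -- The defect in the triangle inequality lies between 0 and 2|h| and vanishes wherever h does, so
  -- no convergence of g k is needed there.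
  let e : ℕ → ℝ → ℝ≥0∞ := fun k x => ENNReal.ofReal (|g k x - h x| + |h x| - |g k x|)
  have he : ∀ k x, ‖g k x - h x‖ₑ + ‖h x‖ₑ = e k x + ‖g k x‖ₑ := by
    intro k x
    have h1 : 0 ≤ |g k x - h x| + |h x| - |g k x| := by
      have := abs_add_le (g k x - h x) (h x)
      rw [sub_add_cancel] at this
      linarith
    simp only [e, Real.enorm_eq_ofReal_abs]
    rw [← ENNReal.ofReal_add (abs_nonneg _) (abs_nonneg _), ← ENNReal.ofReal_add h1 (abs_nonneg _),
      sub_add_cancel]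
  have hem : ∀ k, Measurable (e k) := fun k =>
    ((((hg k).sub hh).abs.add hh.abs).sub (hg k).abs).ennreal_ofReal
  have hE : Tendsto (fun k => ∫⁻ x, e k x) atTop (𝓝 0) := by
    have := tendsto_lintegral_of_dominated_convergence (F := e) (f := fun _ => 0)
      (fun x => 2 * ‖h x‖ₑ) (μ := volume) hem (fun k => ae_of_all _ fun x => ?_) ?_ ?_
    · simpa using this
    · simp only [e, Real.enorm_eq_ofReal_abs]
      rw [← ENNReal.ofReal_ofNat 2, ← ENNReal.ofReal_mul (by norm_num)]
      refine ENNReal.ofReal_le_ofReal ?_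
      have := abs_sub (g k x) (h x)
      linarith
    · rw [lintegral_const_mul _ hh.enorm]
      exact ENNReal.mul_ne_top ENNReal.ofNat_ne_top hfin
    · filter_upwards [hae] with x hx
      rcases eq_or_ne (h x) 0 with h0 | h0
      · simp [e, h0]
      · have h1 := (((hx h0).sub_const (h x)).abs.add_const |h x|).sub (hx h0).abs
        have h2 := ENNReal.tendsto_ofReal h1
        simpa using h2
  have hbound : ∀ k, ∫⁻ x, ‖g k x - h x‖ₑ ≤ (∫⁻ x, e k x) + ε k := by
    intro k
    have h1 : (∫⁻ x, ‖g k x - h x‖ₑ) + ∫⁻ x, ‖h x‖ₑ = (∫⁻ x, e k x) + ∫⁻ x, ‖g k x‖ₑ := by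
      rw [← lintegral_add_right _ hh.enorm, ← lintegral_add_left (hem k)]
      exact lintegral_congr fun x => he k x
    refine (ENNReal.add_le_add_iff_right hfin).1 ?_
    rw [h1, add_assoc, add_comm (ε k)]
    gcongr
    exact hle k
  have hlim := hE.add hε
  rw [add_zero] at hlim
  exact tendsto_of_tendsto_of_tendsto_of_le_of_le tendsto_const_nhds hlim (fun _ => zero_le) hbound

namespace BV

theorem tendsto_lintegral_deriv_uncenteredMaximal_sub {F : ℕ → BV} {f : BV}
    (hF : Tendsto (fun j => ‖F j - f‖) atTop (𝓝 0)) :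
    Tendsto (fun j => ∫⁻ x, ‖deriv (uncenteredMaximal (F j)) x - deriv (uncenteredMaximal f) x‖ₑ)
      atTop (𝓝 0) := by
  refine tendsto_of_subseq_tendsto fun ns hns => ?_
  obtain ⟨φ, hφ, ε, hε, hle⟩ :=
    exists_subseq_eVariationOn_uncenteredMaximal_le (F := fun n => F (ns n)) (hF.comp hns)
  have hsub : Tendsto (fun n => ns (φ n)) atTop atTop := hns.comp hφ.tendsto_atTop
  refine ⟨φ, tendsto_lintegral_enorm_sub_of_le (fun k => measurable_deriv _) (measurable_deriv _)
    (integrable_deriv f.boundedVariationOn_uncenteredMaximal).2.ne hε (fun k => ?_) ?_⟩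
  · refine (lintegral_enorm_deriv_le (F (ns (φ k))).boundedVariationOn_uncenteredMaximal).trans
      ((hle k).trans ?_)
    gcongr
    exact eVariationOn_le_lintegral_enorm_deriv f.absolutelyContinuousOnInterval_uncenteredMaximal
  · filter_upwards [f.ae_deriv_eq_zero_of_notMem_detachedSet, f.ae_continuousAt,
      f.ae_differentiableAt_uncenteredMaximal, ae_all_iff.2 fun k => (F k).ae_continuousAt,
      ae_all_iff.2 fun k => (F k).ae_differentiableAt_uncenteredMaximal] with x h1 h2 h3 h4 h5 h0
    refine tendsto_deriv_uncenteredMaximal (F := fun n => F (ns (φ n))) (hF.comp hsub) ?_ h2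
      (fun k => h4 _) h3 fun k => h5 _
    by_contra hn
    exact h0 (h1 hn)

theorem abs_limAtBot_le (f : BV) {ε : ℝ} (h : ∀ x, |f x| ≤ ε) : |limAtBot f| ≤ ε :=
  le_of_tendsto f.tendsto_limAtBot.abs (Eventually.of_forall h)

theorem limAtBot_sub (f g : BV) : limAtBot (f - g : BV) = limAtBot f - limAtBot g :=
  (f.tendsto_limAtBot.sub g.tendsto_limAtBot).limUnder_eq

/-- The difference of the two maximal functions is again absolutely continuous; this converts L¹
convergence of derivatives into convergence in variation. -/
theorem eVariationOn_uncenteredMaximal_sub_le (f g : BV) :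
    eVariationOn (uncenteredMaximal f - uncenteredMaximal g) Set.univ ≤
      ∫⁻ x, ‖deriv (uncenteredMaximal f) x - deriv (uncenteredMaximal g) x‖ₑ := by
  refine (eVariationOn_le_lintegral_enorm_deriv fun a b =>
    (f.absolutelyContinuousOnInterval_uncenteredMaximal a b).sub
      (g.absolutelyContinuousOnInterval_uncenteredMaximal a b)).trans (lintegral_mono_ae ?_)
  filter_upwards [f.ae_differentiableAt_uncenteredMaximal,
    g.ae_differentiableAt_uncenteredMaximal] with x h1 h2
  rw [deriv_sub h1 h2]

/-- The maximal function of a function of bounded variation, as an element of `BV`. -/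
noncomputable def maximal (f : BV) : BV :=
  mk (uncenteredMaximal f) f.boundedVariationOn_uncenteredMaximal

theorem abs_limAtBot_maximal_sub_le (f g : BV) :
    |limAtBot (f.maximal - g.maximal : BV)| ≤ ‖f - g‖ :=
  abs_limAtBot_le _ (abs_uncenteredMaximal_sub_le f g (abs_sub_le_norm f g))

theorem continuous_maximal : Continuous maximal := by
  refine continuous_iff_seqContinuous.2 fun F f hF => ?_
  rw [tendsto_iff_norm_sub_tendsto_zero] at hF ⊢
  have h1 := tendsto_lintegral_deriv_uncenteredMaximal_sub hF
  have h2 : Tendsto (fun j => eVariationOn (uncenteredMaximal (F j) - uncenteredMaximal f)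
      Set.univ) atTop (𝓝 0) :=
    tendsto_of_tendsto_of_tendsto_of_le_of_le tendsto_const_nhds h1 (fun _ => zero_le)
      fun j => eVariationOn_uncenteredMaximal_sub_le _ _
  have h3 := (ENNReal.tendsto_toReal ENNReal.zero_ne_top).comp h2
  have h4 := hF.add h3
  rw [ENNReal.toReal_zero, add_zero] at h4
  refine squeeze_zero (fun _ => norm_nonneg _) (fun j => ?_) h4
  exact add_le_add (abs_limAtBot_maximal_sub_le (F j) f) le_rfl

end BV

end BVMax

theorem theorem1 :
    ∃ hM : ∀ f : BVMax.BV, BoundedVariationOn (BVMax.uncenteredMaximal f) Set.univ,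
      -- the map `f ↦ M̃ f` from `BV(ℝ)` to `BV(ℝ)` is continuous
      Continuous (fun f : BVMax.BV => BVMax.BV.mk (BVMax.uncenteredMaximal f) (hM f)) ∧
      -- `M̃ f` is locally absolutely continuous with integrable derivative
      (∀ f : BVMax.BV,
        (∀ a b : ℝ, AbsolutelyContinuousOnInterval (BVMax.uncenteredMaximal f) a b) ∧
        Integrable (deriv (BVMax.uncenteredMaximal f)) volume) ∧
      -- convergence of the limits at `-∞`, and of the derivatives in `L¹`
      ∀ (F : ℕ → BVMax.BV) (f : BVMax.BV),
        Tendsto (fun j => ‖F j - f‖) atTop (𝓝 0) →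
        Tendsto (fun j => BVMax.limAtBot (BVMax.uncenteredMaximal (F j))) atTop
          (𝓝 (BVMax.limAtBot (BVMax.uncenteredMaximal f))) ∧
        Tendsto (fun j => eLpNorm (fun x => deriv (BVMax.uncenteredMaximal (F j)) x -
          deriv (BVMax.uncenteredMaximal f) x) 1 volume) atTop (𝓝 0) := by
  refine ⟨BVMax.BV.boundedVariationOn_uncenteredMaximal, BVMax.BV.continuous_maximal,
    fun f => ⟨f.absolutelyContinuousOnInterval_uncenteredMaximal,
      BVMax.integrable_deriv f.boundedVariationOn_uncenteredMaximal⟩, fun F f hF => ⟨?_, ?_⟩⟩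
  · refine tendsto_iff_dist_tendsto_zero.2 (squeeze_zero (fun _ => dist_nonneg) (fun j => ?_) hF)
    have h := BVMax.BV.abs_limAtBot_maximal_sub_le (F j) f
    rwa [BVMax.BV.limAtBot_sub] at h
  · simp_rw [eLpNorm_one_eq_lintegral_enorm]
    exact BVMax.BV.tendsto_lintegral_deriv_uncenteredMaximal_sub hF
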